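/- Let $\mathcal A=(a_i)_{i\in I}$ be a point configuration in $\mathbb R^d$, that is, a finite family of points (repetitions allowed) whose affine hull is $\mathbb R^d$. Subconfigurations are nonempty sets $F\subseteq I$ of labels, $\operatorname{conv}F$ denotes $\operatorname{conv}\{a_i: i\in F\}$, and a face of $F$ is $F$ itself or the set of labels of $F$ whose points lie on a supporting hyperplane of $\operatorname{conv}F$. A subdivision of $\mathcal A$ is a collection $\Sigma$ of subconfigurations that is closed under taking faces, with $\bigcup_{F\in\Sigma}\operatorname{conv}F=\operatorname{conv}\mathcal A$ and $\operatorname{relint}\operatorname{conv}F\cap\operatorname{relint}\operatorname{conv}F'=\emptyset$ for distinct $F,F'\in\Sigma$. It refines $\Sigma'$ if each $F\in\Sigma$ is contained in some $F'\in\Sigma'$. The trivial subdivision consists of all faces of $I$. A nontrivial subdivision is coarsest if the only subdivisions it refines are itself and the trivial one. A $k$-split is a coarsest subdivision with exactly $k$ maximal faces that has a face of codimension $k-1$ not contained in the boundary of $\operatorname{conv}\mathcal A$. For a weight function $w:I\to\mathbb R$, let $\Sigma_w(\mathcal A)$ be the regular subdivision, whose faces are the sets $\{i:(w(i),a_i)\in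 B\}$ for the nonempty bounded faces $B$ of $\operatorname{conv}\{(w(i),a_i)\}+\mathbb R_{\ge0}(1,0,\dots,0)\subset\mathbb R\times\mathbb R^d$, and let $$\mathcal E_w(\mathcal A)=\{x\in\mathbb R\times\mathbb R^d:\langle(1,a_i),x\rangle\ge -w(i)\ \text{for all } i\in I\}$$ be its envelope. A decomposition $w=\sum_j w_j$ into finitely many weight functions is coherent if $\mathcal E_w(\mathcal A)=\sum_j\mathcal E_{w_j}(\mathcal A)$ (Minkowski sum). Call $w$ split prime if $\Sigma_w(\mathcal A)$ refines no $1$-split and no $2$-split. For $p\in I$ let $S^p$ be the collection of faces of $I\setminus\{p\}$ and let $w_p$ be $1$ at $p$ and $0$ elsewhere. For each $2$-split $S$ fix one of its two maximal faces, $S_+$, call the other $S_-$, let $H_S$ be the affine span of the points with labels in $S_+\cap S_-$, and put $w_S(i)=\operatorname{dist}(a_i,H_S)$ for $i\in S_+$ and $w_S(i)=0$ for $i\notin S_+$. Theorem (Split Decomposition Theorem for Point Configurations). Every weight function $w:I\to\mathbb R$ has a coherent decomposition $$w=w_0+\sum_{p:\ S^p\text{ is a }1\text{-split}}\lambda_p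 w_p+\sum_{S\text{ a }2\text{-split}}\lambda_S w_S$$ with all $\lambda_p,\lambda_S\ge0$ and $w_0$ split prime, and $w_0$, $(\lambda_p)$, $(\lambda_S)$ are uniquely determined by these properties. -/

import Mathlib

open scoped Pointwise

noncomputable section

namespace PointConfig

/-! A point configuration in `ℝ^d` is a finite family `a : ι → ℝ^d`, so that repeated points are
distinguished by their labels; subconfigurations are sets of labels. -/

variable {d : ℕ} {ι : Type*}

/-- `F` is a (nonempty) face of the subconfiguration `G`: the points of `G` on some hyperplane
`⟪u, x⟫ = c` that supports `conv G`. The case `u = 0`, `c = 0` makes `G` a face of itself. -/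
def IsFace (a : ι → EuclideanSpace ℝ (Fin d)) (F G : Set ι) : Prop :=
  F.Nonempty ∧ ∃ (u : EuclideanSpace ℝ (Fin d)) (c : ℝ),
    (∀ i ∈ G, c ≤ inner ℝ u (a i)) ∧ F = {i ∈ G | inner ℝ u (a i) = c}

/-- The convex hull of the points of a subconfiguration. -/
def hull (a : ι → EuclideanSpace ℝ (Fin d)) (F : Set ι) : Set (EuclideanSpace ℝ (Fin d)) :=
  convexHull ℝ (a '' F)

/-- Subdivisions of a point configuration, as collections of nonempty subconfigurations. -/
structure IsSubdivision (a : ι → EuclideanSpace ℝ (Fin d)) (S : Set (Set ι)) : Prop where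
  nonempty : ∀ F ∈ S, F.Nonempty
  face_mem : ∀ F ∈ S, ∀ F', IsFace a F' F → F' ∈ S
  cover : hull a Set.univ = ⋃ F ∈ S, hull a F
  disjoint : ∀ F ∈ S, ∀ F' ∈ S, F ≠ F' →
    intrinsicInterior ℝ (hull a F) ∩ intrinsicInterior ℝ (hull a F') = ∅

/-- The trivial subdivision: the whole configuration and all its faces. -/
def trivialSubdivision (a : ι → EuclideanSpace ℝ (Fin d)) : Set (Set ι) :=
  {F | IsFace a F Set.univ}

/-- `S` is a refinement of `T`. -/
def Refines (S T : Set (Set ι)) : Prop :=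
  ∀ F ∈ S, ∃ G ∈ T, F ⊆ G

/-- A coarsest subdivision: nontrivial, and properly coarsened only by the trivial subdivision. -/
def IsCoarsest (a : ι → EuclideanSpace ℝ (Fin d)) (S : Set (Set ι)) : Prop :=
  IsSubdivision a S ∧ S ≠ trivialSubdivision a ∧
    ∀ T, IsSubdivision a T → Refines S T → T = S ∨ T = trivialSubdivision a

/-- The inclusion-maximal faces of a subdivision. -/
def maximalFaces (S : Set (Set ι)) : Set (Set ι) :=
  {F | Maximal (· ∈ S) F}

/-- `F` is not entirely contained in the boundary of the convex hull of the configuration. -/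
def IsInterior (a : ι → EuclideanSpace ℝ (Fin d)) (F : Set ι) : Prop :=
  ¬ hull a F ⊆ frontier (hull a Set.univ)

/-- A `k`-split (`k ≥ 1`) of a `d`-dimensional configuration: a coarsest subdivision with `k`
maximal faces that has an interior face of codimension `k - 1`. -/
def IsKSplit (a : ι → EuclideanSpace ℝ (Fin d)) (k : ℕ) (S : Set (Set ι)) : Prop :=
  IsCoarsest a S ∧ (maximalFaces S).ncard = k ∧
    ∃ F ∈ S, IsInterior a F ∧ Module.finrank ℝ (vectorSpan ℝ (a '' F)) + k = d + 1

/-- The lifted polyhedron of a weight function, in `ℝ × ℝ^d`. -/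
def lift (a : ι → EuclideanSpace ℝ (Fin d)) (w : ι → ℝ) : Set (ℝ × EuclideanSpace ℝ (Fin d)) :=
  convexHull ℝ (Set.range fun i => (w i, a i)) +
    (fun t : ℝ => (t, (0 : EuclideanSpace ℝ (Fin d)))) '' Set.Ici 0

/-- The regular subdivision of a weight function, given by the bounded (equivalently, lower) faces
of the lifted polyhedron. -/
def regularSubdivision (a : ι → EuclideanSpace ℝ (Fin d)) (w : ι → ℝ) : Set (Set ι) :=
  {F | ∃ B : Set (ℝ × EuclideanSpace ℝ (Fin d)), B.Nonempty ∧ IsExposed ℝ (lift a w) B ∧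
    Bornology.IsBounded B ∧ F = {i | (w i, a i) ∈ B}}

/-- The envelope of the configuration with respect to a weight function. -/
def envelope (a : ι → EuclideanSpace ℝ (Fin d)) (w : ι → ℝ) :
    Set (ℝ × EuclideanSpace ℝ (Fin d)) :=
  {x | ∀ i, -w i ≤ x.1 + inner ℝ (a i) x.2}

/-- The collection `S^p` with the unique maximal face `A ∖ {p}`. -/
def pointSplit (a : ι → EuclideanSpace ℝ (Fin d)) (p : ι) : Set (Set ι) :=
  {F | IsFace a F {p}ᶜ}

/-- The labels `p` for which `S^p` is a `1`-split. -/
abbrev OneSplit (a : ι → EuclideanSpace ℝ (Fin d)) : Type _ :=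
  {p : ι // IsKSplit a 1 (pointSplit a p)}

/-- The `2`-splits of a configuration. -/
abbrev TwoSplit (a : ι → EuclideanSpace ℝ (Fin d)) : Type _ :=
  {S : Set (Set ι) // IsKSplit a 2 S}

instance [Finite ι] (a : ι → EuclideanSpace ℝ (Fin d)) : Fintype (OneSplit a) :=
  Fintype.ofFinite _

instance [Finite ι] (a : ι → EuclideanSpace ℝ (Fin d)) : Fintype (TwoSplit a) :=
  Fintype.ofFinite _

/-- The weight function `w_p` of the `1`-split `S^p`: it is `1` at `p` and `0` elsewhere. -/
def pointWeight (p : ι) : ι → ℝ :=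
  Set.indicator {p} 1

/-- The hyperplane of a `2`-split, spanned by the points common to its maximal faces. -/
def splitHyperplane (a : ι → EuclideanSpace ℝ (Fin d)) (S : Set (Set ι)) :
    AffineSubspace ℝ (EuclideanSpace ℝ (Fin d)) :=
  affineSpan ℝ (a '' ⋂₀ maximalFaces S)

/-- The weight function `w_S` of a `2`-split `S` with chosen positive side `P`, one of its two
maximal faces: the distance to the split hyperplane on `P`, and `0` on the other side. -/
def splitWeight (a : ι → EuclideanSpace ℝ (Fin d)) (S : Set (Set ι)) (P : Set ι) : ι → ℝ :=
  P.indicator fun i => Metric.infDist (a i) (splitHyperplane a S)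

/-- `w` is split prime: its regular subdivision refines no `1`-split and no `2`-split. -/
def SplitPrime (a : ι → EuclideanSpace ℝ (Fin d)) (w : ι → ℝ) : Prop :=
  ∀ S, IsKSplit a 1 S ∨ IsKSplit a 2 S → ¬ Refines (regularSubdivision a w) S

/-- `w = w₀ + ∑ lam p • w_p + ∑ mu S • w_S` is a coherent decomposition into `1`-splits, `2`-splits
and a split prime weight function, where `side S` is the positive side of the `2`-split `S`. The
last clause is coherence: the envelope of the sum is the Minkowski sum of the envelopes. -/
structure IsSplitDecomposition [Finite ι] (a : ι → EuclideanSpace ℝ (Fin d))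
    (side : TwoSplit a → Set ι) (w w₀ : ι → ℝ) (lam : OneSplit a → ℝ) (mu : TwoSplit a → ℝ) :
    Prop where
  lam_nonneg : ∀ p, 0 ≤ lam p
  mu_nonneg : ∀ S, 0 ≤ mu S
  prime : SplitPrime a w₀
  sum_eq : w = w₀ + ∑ p, lam p • pointWeight p.1 + ∑ S, mu S • splitWeight a S.1 (side S)
  coherent : envelope a w = envelope a w₀ + ∑ p, envelope a (lam p • pointWeight p.1) +
    ∑ S, envelope a (mu S • splitWeight a S.1 (side S))

end PointConfig

end

/-!
The lower hull of a weight, the largest convex function below it on the convex hull of the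
configuration, is additive under coherent decompositions, and a weight is split prime if and only if
it agrees with its lower hull and every split hyperplane properly cuts some cell of its regular
subdivision.

*Existence.* Replacing a weight by its lower hull does not change its envelope, and the difference
is supported on the labels of `1`-splits. From a weight that agrees with its lower hull, subtract
for each `2`-split in turn the multiple of its weight at which its hyperplane first cuts a cell
properly; the decomposition is coherent up to there, and later subtractions preserve the cut cells.

*Uniqueness.* Inside a cell of `w₀` that is cut by the hyperplane of a `2`-split `S`, the lower hull
of `w₀` is affine and no other split hyperplane passes through a generic point of that hyperplane.
At such a point the second difference of the lower hull of `w` across the hyperplane comes from `S`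
alone, hence determines its coefficient. Since lower hulls are convex, no other decomposition of `w`
can have a larger coefficient there.
-/

open scoped Topology

noncomputable section

namespace PointConfig

variable {d : ℕ} {ι : Type*}

/-! ### Affine functionals and convex sets -/

section Module

variable {E : Type*} [AddCommGroup E] [Module ℝ E]

lemma affineMap_apply_add (f : E →ᵃ[ℝ] ℝ) (z v : E) : f (z + v) = f z + f.linear v := by
  rw [add_comm z, ← vadd_eq_add, f.map_vadd, vadd_eq_add, add_comm]

lemma exists_eq_smul_of_forall_eq_zero {f g : E →ᵃ[ℝ] ℝ} (hf : f.linear ≠ 0)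
    (h : ∀ y, f y = 0 → g y = 0) : ∃ c : ℝ, g = c • f := by
  obtain ⟨v, hv⟩ := LinearMap.surjective hf 1
  refine ⟨g.linear v, AffineMap.ext fun y => ?_⟩
  have key (k : E →ᵃ[ℝ] ℝ) : k (y - f y • v) = k y - f y * k.linear v := by
    rw [sub_eq_add_neg, ← neg_smul, affineMap_apply_add, map_smul, smul_eq_mul]
    ring
  have hg := h _ ((key f).trans (by rw [hv, mul_one, sub_self]))
  rw [key, sub_eq_zero] at hg
  rw [hg, AffineMap.coe_smul, Pi.smul_apply, smul_eq_mul, mul_comm]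

lemma apply_nonpos_of_mem_convexHull {s : Set E} {f : E →ᵃ[ℝ] ℝ} (hf : ∀ y ∈ s, f y ≤ 0) {z : E}
    (hz : z ∈ convexHull ℝ s) : f z ≤ 0 :=
  convexHull_min hf ((convex_Iic 0).affine_preimage f) hz

lemma mem_convexHull_of_apply_eq_zero {s : Set E} {f : E →ᵃ[ℝ] ℝ} (hf : ∀ y ∈ s, f y ≤ 0) {z : E}
    (hz : z ∈ convexHull ℝ s) (hfz : f z = 0) : z ∈ convexHull ℝ {y ∈ s | f y = 0} := by
  let T : Set E := {y | f y ≤ 0 ∧ (f y = 0 → y ∈ convexHull ℝ {y ∈ s | f y = 0})}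
  have hsT : s ⊆ T := fun y hy => ⟨hf y hy, fun h => subset_convexHull ℝ _ ⟨hy, h⟩⟩
  suffices hT : Convex ℝ T from (convexHull_min hsT hT hz).2 hfz
  refine convex_iff_forall_pos.2 fun y hy y' hy' s t hs ht hst => ⟨?_, fun h => ?_⟩
  · exact (convex_Iic 0).affine_preimage f hy.1 hy'.1 hs.le ht.le hst
  · rw [Convex.combo_affine_apply hst, smul_eq_mul, smul_eq_mul] at h
    have hfy : f y = 0 := by nlinarith [hy.1, hy'.1]
    have hfy' : f y' = 0 := by nlinarith [hy.1, hy'.1]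
    exact convex_convexHull ℝ _ (hy.2 hfy) (hy'.2 hfy') hs.le ht.le hst

end Module

section Normed

variable {E : Type*} [NormedAddCommGroup E] [NormedSpace ℝ E]

lemma exists_lineMap_mem_of_mem_intrinsicInterior {C : Set E} {y z : E}
    (hz : z ∈ intrinsicInterior ℝ C) (hy : y ∈ C) : ∃ t > (1 : ℝ), AffineMap.lineMap y z t ∈ C := by
  obtain ⟨z, hzi, rfl⟩ := mem_intrinsicInterior.1 hz
  let y' : affineSpan ℝ C := ⟨y, subset_affineSpan ℝ C hy⟩
  have hline (t : ℝ) : AffineMap.lineMap y (z : E) t ∈ affineSpan ℝ C :=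
    AffineMap.lineMap_mem t y'.2 z.2
  have hcont : Continuous fun t : ℝ => (⟨_, hline t⟩ : affineSpan ℝ C) :=
    (AffineMap.lineMap_continuous (R := ℝ)).subtype_mk _
  have hlim : Filter.Tendsto (fun t : ℝ => (⟨_, hline t⟩ : affineSpan ℝ C)) (nhds 1) (nhds z) :=
    (hcont.tendsto 1).trans_eq (congrArg nhds (Subtype.ext (AffineMap.lineMap_apply_one _ _)))
  have hmem : ∀ᶠ t in nhds (1 : ℝ), AffineMap.lineMap y (z : E) t ∈ C :=
    hlim (mem_interior_iff_mem_nhds.1 hzi)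
  obtain ⟨t, htC, ht⟩ := ((hmem.filter_mono nhdsWithin_le_nhds).and
    (self_mem_nhdsWithin : Set.Ioi (1 : ℝ) ∈ nhdsWithin 1 (Set.Ioi 1))).exists
  exact ⟨t, ht, htC⟩

lemma eq_zero_of_nonpos_of_mem_intrinsicInterior {C : Set E} {f : E →ᵃ[ℝ] ℝ}
    (hf : ∀ y ∈ C, f y ≤ 0) {z : E} (hz : z ∈ intrinsicInterior ℝ C) (hfz : f z = 0) {y : E}
    (hy : y ∈ C) : f y = 0 := by
  obtain ⟨t, ht, htC⟩ := exists_lineMap_mem_of_mem_intrinsicInterior hz hy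
  have hle := hf _ htC
  rw [AffineMap.apply_lineMap, hfz, AffineMap.lineMap_apply_ring'] at hle
  nlinarith [hf y hy]

lemma mem_interior_of_mem_intrinsicInterior {C D : Set E} {z : E} (hC : Convex ℝ C)
    (hDC : D ⊆ C) (hD : ¬ D ⊆ frontier C) (hz : z ∈ intrinsicInterior ℝ D) : z ∈ interior C := by
  obtain ⟨y, hyD, hy⟩ := Set.not_subset.1 hD
  have hyi : y ∈ interior C := by
    by_contra hyi
    exact hy ⟨subset_closure (hDC hyD), hyi⟩
  obtain ⟨t, ht, htD⟩ := exists_lineMap_mem_of_mem_intrinsicInterior hz hyD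
  refine hC.openSegment_interior_self_subset_interior hyi (hDC htD) ?_
  rw [openSegment_eq_image_lineMap]
  have ht0 : 0 < t := one_pos.trans ht
  refine ⟨t⁻¹, ⟨inv_pos.2 ht0, inv_lt_one_of_one_lt₀ ht⟩, ?_⟩
  rw [AffineMap.lineMap_lineMap_right, inv_mul_cancel₀ ht0.ne', AffineMap.lineMap_apply_one]

lemma exists_strongDual_nonpos_of_zero_notMem_interior {D : Set E} (hD : Convex ℝ D)
    (h₀ : (0 : E) ∉ interior D) {v : E} (hv : v ∈ interior D) :
    ∃ f : StrongDual ℝ E, (∀ y ∈ D, f y ≤ 0) ∧ f v < 0 := by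
  obtain ⟨f, hf⟩ := geometric_hahn_banach_open_point hD.interior isOpen_interior h₀
  rw [map_zero] at hf
  refine ⟨f, fun y hy => ?_, hf v hv⟩
  have hy' : y ∈ closure (interior D) := by
    rw [hD.closure_interior_eq_closure_of_nonempty_interior ⟨v, hv⟩]
    exact subset_closure hy
  exact closure_minimal (fun u hu => (hf u hu).le) (isClosed_le f.continuous continuous_const) hy'

lemma exists_supporting_of_notMem_intrinsicInterior [FiniteDimensional ℝ E] {C : Set E}
    (hC : Convex ℝ C) {z : E} (hz : z ∈ C) (hz' : z ∉ intrinsicInterior ℝ C) :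
    ∃ f : E →ᵃ[ℝ] ℝ, (∀ y ∈ C, f y ≤ 0) ∧ f z = 0 ∧ ∃ y ∈ C, f y < 0 := by
  let A := affineSpan ℝ C
  let z₀ : A := ⟨z, subset_affineSpan ℝ C hz⟩
  have : Nonempty A := ⟨z₀⟩
  let e : A.direction ≃ᵃⁱ[ℝ] A := AffineIsometryEquiv.vaddConst ℝ z₀
  let D : Set A.direction := {v | (e v : E) ∈ C}
  have hD : Convex ℝ D := hC.affine_preimage (A.subtype.comp e.toAffineEquiv.toAffineMap)
  have hint (v : A.direction) : v ∈ interior D ↔ (e v : E) ∈ intrinsicInterior ℝ C := by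
    have hpre : e ⁻¹' interior ((↑) ⁻¹' C : Set A) = interior D :=
      e.toHomeomorph.preimage_interior _
    rw [← hpre, intrinsicInterior, Subtype.val_injective.mem_set_image, Set.mem_preimage]
  have he (y : E) (hy : y ∈ C) : ∃ v, (e v : E) = y :=
    (e.surjective ⟨y, subset_affineSpan ℝ C hy⟩).imp fun v hv => congrArg Subtype.val hv
  obtain ⟨z₁, hz₁⟩ := (intrinsicInterior_nonempty hC).2 ⟨z, hz⟩
  obtain ⟨v₁, rfl⟩ := he z₁ (intrinsicInterior_subset hz₁)
  obtain ⟨g, hg, hgv₁⟩ := exists_strongDual_nonpos_of_zero_notMem_interior hD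
    (by simpa [hint, e, z₀] using hz') ((hint v₁).2 hz₁)
  obtain ⟨g', hg'⟩ := LinearMap.exists_extend g.toLinearMap
  let f : E →ᵃ[ℝ] ℝ := g'.toAffineMap - AffineMap.const ℝ E (g' z)
  have hf (v : A.direction) : f (e v) = g v := by
    simpa [f, e, z₀] using LinearMap.congr_fun hg' v
  refine ⟨f, fun y hy => ?_, by simp [f], e v₁, intrinsicInterior_subset hz₁, ?_⟩
  · obtain ⟨v, rfl⟩ := he y hy
    exact (hf v).trans_le (hg v hy)
  · exact (hf v₁).trans_lt hgv₁

end Normed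

section ToAffine

variable {E : Type*} [NormedAddCommGroup E] [InnerProductSpace ℝ E]

/-- The affine functional `y ↦ -(x.1 + ⟪y, x.2⟫)` encoded by a point `x` of `ℝ × E`. The sign is
chosen so that `envelope a w` consists of the functionals that are at most `w i` at each `a i`. -/
def toAffine : ℝ × E →ₗ[ℝ] E →ᵃ[ℝ] ℝ where
  toFun x := -((innerₗ E x.2).toAffineMap + AffineMap.const ℝ E x.1)
  map_add' x x' := by ext y; simp [add_add_add_comm, add_comm]
  map_smul' c x := by ext y; simp

lemma toAffine_apply (x : ℝ × E) (y : E) : toAffine x y = -(x.1 + inner ℝ y x.2) := by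
  simp [toAffine, real_inner_comm, add_comm]

lemma toAffine_add_right (x : ℝ × E) (y v : E) :
    toAffine x (y + v) = toAffine x y - inner ℝ v x.2 := by
  simp only [toAffine_apply, inner_add_left]
  ring

lemma toAffine_add_smul (x m : ℝ × E) (t : ℝ) (y : E) :
    toAffine (x + t • m) y = toAffine x y + t * toAffine m y := by
  simp

lemma toAffine_sub_smul (x m : ℝ × E) (t : ℝ) (y : E) :
    toAffine (x - t • m) y = toAffine x y - t * toAffine m y := by
  simp

lemma toAffine_linear_ne_zero {h : ℝ × E} (hh : h.2 ≠ 0) : (toAffine h).linear ≠ 0 := by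
  intro h0
  have hlin := affineMap_apply_add (toAffine h) 0 h.2
  rw [h0, toAffine_add_right] at hlin
  simp [hh] at hlin

lemma toAffine_injective : Function.Injective (toAffine (E := E)) := by
  refine (injective_iff_map_eq_zero _).2 fun x hx => ?_
  have h (y : E) : toAffine x y = 0 := by rw [hx, AffineMap.coe_zero, Pi.zero_apply]
  have h₁ : x.1 = 0 := by simpa [toAffine_apply] using h 0
  have h₂ : x.2 = 0 := by simpa [toAffine_apply, h₁] using h x.2
  exact Prod.ext h₁ h₂

lemma toAffine_surjective [FiniteDimensional ℝ E] : Function.Surjective (toAffine (E := E)) := by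
  intro f
  let u : E := (InnerProductSpace.toDual ℝ E).symm (LinearMap.toContinuousLinearMap f.linear)
  refine ⟨(-f 0, -u), AffineMap.ext fun y => ?_⟩
  have hu : inner ℝ y u = f.linear y := by
    rw [real_inner_comm, InnerProductSpace.toDual_symm_apply, LinearMap.coe_toContinuousLinearMap']
  rw [toAffine_apply, inner_neg_right, hu, f.decomp', Pi.sub_apply]
  ring

lemma exists_toAffine_of_strongDual [FiniteDimensional ℝ E] (l : StrongDual ℝ (ℝ × E))
    (hl : l (1, 0) ≠ 0) (r : ℝ) :
    ∃ x : ℝ × E, ∀ y : ℝ × E, l y - r = l (1, 0) * (y.1 - toAffine x y.2) := by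
  obtain ⟨x, hx⟩ := toAffine_surjective ((l (1, 0))⁻¹ •
    (AffineMap.const ℝ E r - (l.toLinearMap ∘ₗ LinearMap.inr ℝ ℝ E).toAffineMap))
  refine ⟨x, fun y => ?_⟩
  have hly : l y = y.1 * l (1, 0) + l (0, y.2) := by
    rw [← smul_eq_mul, ← map_smul, ← map_add]
    simp
  have hxy : l (1, 0) * toAffine x y.2 = r - l (0, y.2) := by
    rw [hx]
    exact mul_inv_cancel_left₀ hl _
  linear_combination hly + hxy

lemma affineSpan_eq_top_iff_forall_toAffine [FiniteDimensional ℝ E] {s : Set E} :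
    affineSpan ℝ s = ⊤ ↔ ∀ x : ℝ × E, (∀ y ∈ s, toAffine x y = 0) → x = 0 := by
  refine ⟨fun hs x hx => toAffine_injective ?_, fun h => ?_⟩
  · rw [map_zero]
    exact AffineMap.ext_on hs fun y hy => by rw [hx y hy, AffineMap.coe_zero, Pi.zero_apply]
  by_contra hs
  suffices hf : ∃ f : E →ᵃ[ℝ] ℝ, f ≠ 0 ∧ ∀ y ∈ s, f y = 0 by
    obtain ⟨f, hf, hfs⟩ := hf
    obtain ⟨x, rfl⟩ := toAffine_surjective f
    exact hf (by rw [h x hfs, map_zero])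
  rcases s.eq_empty_or_nonempty with rfl | ⟨y₀, hy₀⟩
  · exact ⟨AffineMap.const ℝ E 1, fun h => one_ne_zero (AffineMap.congr_fun h 0), by simp⟩
  rw [AffineSubspace.affineSpan_eq_top_iff_vectorSpan_eq_top_of_nonempty ℝ _ _ ⟨y₀, hy₀⟩] at hs
  obtain ⟨g, hg, hgs⟩ := Submodule.exists_le_ker_of_lt_top _ (lt_top_iff_ne_top.2 hs)
  refine ⟨g.toAffineMap - AffineMap.const ℝ E (g y₀), fun hf => hg ?_, fun y hy => ?_⟩
  · simpa using congrArg AffineMap.linear hf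
  · simpa using hgs (vsub_mem_vectorSpan ℝ hy hy₀)

lemma exists_mem_iff_toAffine_eq_zero [FiniteDimensional ℝ E] {V : AffineSubspace ℝ E}
    (hne : (V : Set E).Nonempty)
    (hV : Module.finrank ℝ V.direction + 1 = Module.finrank ℝ E) :
    ∃ h : ℝ × E, ‖h.2‖ = 1 ∧ ∀ y, y ∈ V ↔ toAffine h y = 0 := by
  obtain ⟨y₀, hy₀⟩ := hne
  have hlt : V.direction ≠ ⊤ := fun h => by
    rw [h, finrank_top] at hV
    omega
  obtain ⟨v, hv, hv₀⟩ := Submodule.exists_mem_ne_zero_of_ne_bot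
    (mt Submodule.orthogonal_eq_bot_iff.1 hlt)
  let u : E := ‖v‖⁻¹ • v
  have hu : ‖u‖ = 1 := norm_smul_inv_norm (𝕜 := ℝ) hv₀
  have hdir : V.direction = (Submodule.span ℝ {u})ᗮ := by
    refine Submodule.eq_of_le_of_finrank_eq ?_ ?_
    · rw [Submodule.le_orthogonal_iff_le_orthogonal, Submodule.span_singleton_le_iff_mem]
      exact Submodule.smul_mem _ _ hv
    · have := Submodule.finrank_add_finrank_orthogonal (Submodule.span ℝ {u})
      rw [finrank_span_singleton (norm_ne_zero_iff.1 (hu ▸ one_ne_zero))] at this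
      omega
  refine ⟨(-inner ℝ y₀ u, u), hu, fun y => ?_⟩
  rw [← AffineSubspace.vsub_right_mem_direction_iff_mem hy₀, hdir,
    Submodule.mem_orthogonal_singleton_iff_inner_left, vsub_eq_sub, inner_sub_left, toAffine_apply,
    neg_eq_zero, add_comm, sub_eq_add_neg]

lemma infDist_eq_abs_toAffine {V : AffineSubspace ℝ E} {h : ℝ × E} (hnorm : ‖h.2‖ = 1)
    (hV : ∀ y, y ∈ V ↔ toAffine h y = 0) (y : E) : Metric.infDist y V = |toAffine h y| := by
  have hself : inner ℝ h.2 h.2 = (1 : ℝ) := by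
    rw [real_inner_self_eq_norm_sq, hnorm, one_pow]
  have hmem : y + toAffine h y • h.2 ∈ V := by
    rw [hV, toAffine_add_right, inner_smul_left, hself, mul_one, RCLike.conj_to_real, sub_self]
  refine le_antisymm ?_ ((Metric.le_infDist ⟨_, hmem⟩).2 fun y' hy' => ?_)
  · refine (Metric.infDist_le_dist_of_mem hmem).trans_eq ?_
    rw [dist_eq_norm, sub_add_cancel_left, norm_neg, norm_smul, hnorm, mul_one, Real.norm_eq_abs]
  · have hsub := toAffine_add_right h y' (y - y')
    rw [add_sub_cancel, (hV y').1 hy', zero_sub] at hsub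
    rw [hsub, abs_neg, dist_eq_norm]
    exact (abs_real_inner_le_norm _ _).trans_eq (by rw [hnorm, mul_one])

end ToAffine

/-! ### Faces and subdivisions -/

section Faces

variable {a : ι → EuclideanSpace ℝ (Fin d)} {F F' G H : Set ι} {y z : EuclideanSpace ℝ (Fin d)}
  {f g : EuclideanSpace ℝ (Fin d) →ᵃ[ℝ] ℝ} {S : Set (Set ι)}

lemma mem_hull {i : ι} (hi : i ∈ F) : a i ∈ hull a F :=
  subset_convexHull ℝ _ ⟨i, hi, rfl⟩

lemma hull_mono (h : F ⊆ G) : hull a F ⊆ hull a G :=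
  convexHull_mono (Set.image_mono h)

lemma convex_hull : Convex ℝ (hull a F) :=
  convex_convexHull ℝ _

lemma isClosed_hull [Finite ι] : IsClosed (hull a F) :=
  ((Set.toFinite (a '' F)).isCompact_convexHull (𝕜 := ℝ)).isClosed

lemma hull_nonempty : (hull a F).Nonempty ↔ F.Nonempty := by
  rw [hull, convexHull_nonempty_iff, Set.image_nonempty]

lemma intrinsicInterior_hull_nonempty (hF : F.Nonempty) :
    (intrinsicInterior ℝ (hull a F)).Nonempty :=
  (intrinsicInterior_nonempty convex_hull).2 (hull_nonempty.2 hF)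

lemma interior_hull_nonempty (hF : affineSpan ℝ (a '' F) = ⊤) : (interior (hull a F)).Nonempty :=
  interior_convexHull_nonempty_iff_affineSpan_eq_top.2 hF

lemma apply_le_apply_of_mem_hull (h : ∀ i ∈ F, f (a i) ≤ g (a i)) (hy : y ∈ hull a F) :
    f y ≤ g y := by
  refine sub_nonpos.1 (apply_nonpos_of_mem_convexHull (f := f - g) ?_ hy)
  rintro _ ⟨i, hi, rfl⟩
  exact sub_nonpos.2 (h i hi)

lemma apply_nonpos_of_mem_hull (h : ∀ i ∈ F, f (a i) ≤ 0) (hy : y ∈ hull a F) : f y ≤ 0 :=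
  apply_le_apply_of_mem_hull (g := 0) h hy

lemma apply_nonneg_of_mem_hull (h : ∀ i ∈ F, 0 ≤ f (a i)) (hy : y ∈ hull a F) : 0 ≤ f y :=
  apply_le_apply_of_mem_hull (f := 0) h hy

lemma apply_eq_apply_of_mem_hull (h : ∀ i ∈ F, f (a i) = g (a i)) (hy : y ∈ hull a F) :
    f y = g y :=
  (apply_le_apply_of_mem_hull (fun i hi => (h i hi).le) hy).antisymm
    (apply_le_apply_of_mem_hull (fun i hi => (h i hi).ge) hy)

lemma apply_label_eq_zero_of_mem_intrinsicInterior (hf : ∀ i ∈ F, f (a i) ≤ 0)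
    (hz : z ∈ intrinsicInterior ℝ (hull a F)) (hfz : f z = 0) : ∀ i ∈ F, f (a i) = 0 :=
  fun _ hi => eq_zero_of_nonpos_of_mem_intrinsicInterior
    (fun _ hy => apply_nonpos_of_mem_hull hf hy) hz hfz (mem_hull hi)

lemma isFace_iff : IsFace a F G ↔ F.Nonempty ∧ ∃ f : EuclideanSpace ℝ (Fin d) →ᵃ[ℝ] ℝ,
    (∀ i ∈ G, f (a i) ≤ 0) ∧ F = {i ∈ G | f (a i) = 0} := by
  have h (u : EuclideanSpace ℝ (Fin d)) (c : ℝ) (i : ι) :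
      toAffine (-c, u) (a i) = c - inner ℝ u (a i) := by
    rw [toAffine_apply, real_inner_comm]
    ring
  refine and_congr_right fun _ => ⟨?_, ?_⟩
  · rintro ⟨u, c, hG, rfl⟩
    refine ⟨toAffine (-c, u), fun i hi => ?_, ?_⟩
    · rw [h]
      exact sub_nonpos.2 (hG i hi)
    · simp only [h, sub_eq_zero, @eq_comm _ c]
  · rintro ⟨f, hf, rfl⟩
    obtain ⟨⟨c, u⟩, rfl⟩ := toAffine_surjective f
    obtain ⟨c, rfl⟩ := neg_surjective c
    refine ⟨u, c, fun i hi => ?_, ?_⟩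
    · exact sub_nonpos.1 ((h u c i).symm.trans_le (hf i hi))
    · simp only [h, sub_eq_zero, @eq_comm _ c]

lemma IsFace.subset (h : IsFace a F G) : F ⊆ G := by
  obtain ⟨-, f, -, rfl⟩ := isFace_iff.1 h
  exact fun i hi => hi.1

lemma IsFace.refl (hG : G.Nonempty) : IsFace a G G :=
  isFace_iff.2 ⟨hG, 0, by simp⟩

/-- A large multiple of the functional exposing `G` in `H` makes the one exposing `F` in `G`
negative off `G`. -/
lemma IsFace.trans [Finite ι] (hFG : IsFace a F G) (hGH : IsFace a G H) : IsFace a F H := by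
  obtain ⟨hne, f, hf, rfl⟩ := isFace_iff.1 hFG
  obtain ⟨-, g, hg, rfl⟩ := isFace_iff.1 hGH
  obtain ⟨M, hM⟩ := (Set.finite_range fun i => (f (a i) + 1) / -g (a i)).bddAbove
  have hneg (i : ι) (hi : i ∈ H) (hgi : g (a i) ≠ 0) : (f + M • g) (a i) < 0 := by
    have hle := hM ⟨i, rfl⟩
    rw [div_le_iff₀ (neg_pos.2 ((hg i hi).lt_of_ne hgi))] at hle
    simp only [AffineMap.coe_add, AffineMap.coe_smul, Pi.add_apply, Pi.smul_apply, smul_eq_mul]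
    linarith
  have heq (i : ι) (hgi : g (a i) = 0) : (f + M • g) (a i) = f (a i) := by simp [hgi]
  refine isFace_iff.2 ⟨hne, f + M • g, fun i hi => ?_, ?_⟩
  · by_cases hgi : g (a i) = 0
    · exact (heq i hgi).trans_le (hf i ⟨hi, hgi⟩)
    · exact (hneg i hi hgi).le
  · ext i
    refine ⟨fun ⟨⟨hi, hgi⟩, hfi⟩ => ⟨hi, (heq i hgi).trans hfi⟩, fun ⟨hi, hfi⟩ => ?_⟩
    by_cases hgi : g (a i) = 0
    · exact ⟨⟨hi, hgi⟩, (heq i hgi).symm.trans hfi⟩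
    · exact absurd hfi (hneg i hi hgi).ne

lemma IsFace.of_subset (hF : IsFace a F H) (hFG : F ⊆ G) (hGH : G ⊆ H) : IsFace a F G := by
  obtain ⟨hne, f, hf, rfl⟩ := isFace_iff.1 hF
  refine isFace_iff.2 ⟨hne, f, fun i hi => hf i (hGH hi), ?_⟩
  ext i
  exact ⟨fun hi => ⟨hFG hi, hi.2⟩, fun hi => ⟨hGH hi.1, hi.2⟩⟩

lemma mem_hull_of_apply_eq_zero (hf : ∀ i ∈ G, f (a i) ≤ 0) (hz : z ∈ hull a G) (hfz : f z = 0) :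
    z ∈ hull a {i ∈ G | f (a i) = 0} := by
  have himage : a '' {i ∈ G | f (a i) = 0} = {y ∈ a '' G | f y = 0} :=
    Set.image_inter_preimage a G {y | f y = 0}
  rw [hull, himage]
  exact mem_convexHull_of_apply_eq_zero (Set.forall_mem_image.2 hf) hz hfz

lemma exists_isFace_mem_intrinsicInterior [Finite ι] (hz : z ∈ hull a G) :
    ∃ F, IsFace a F G ∧ z ∈ intrinsicInterior ℝ (hull a F) := by
  induction hn : G.ncard using Nat.strong_induction_on generalizing G with
  | _ n ih =>
  subst hn
  by_cases hr : z ∈ intrinsicInterior ℝ (hull a G)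
  · exact ⟨G, IsFace.refl (hull_nonempty.1 ⟨z, hz⟩), hr⟩
  obtain ⟨f, hf, hfz, y, hy, hfy⟩ := exists_supporting_of_notMem_intrinsicInterior convex_hull hz hr
  have hfG (i : ι) (hi : i ∈ G) : f (a i) ≤ 0 := hf _ (mem_hull hi)
  have hz' := mem_hull_of_apply_eq_zero hfG hz hfz
  have hface : IsFace a {i ∈ G | f (a i) = 0} G :=
    isFace_iff.2 ⟨hull_nonempty.1 ⟨z, hz'⟩, f, hfG, rfl⟩
  have hproper : {i ∈ G | f (a i) = 0} ⊂ G := by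
    refine hface.subset.ssubset_of_ne fun heq => hfy.not_ge ?_
    exact apply_nonneg_of_mem_hull (fun i hi => (heq.ge hi).2.ge) hy
  obtain ⟨F, hF, hzF⟩ := ih _ (Set.ncard_lt_ncard hproper) hz' rfl
  exact ⟨F, hF.trans hface, hzF⟩

lemma IsFace.subset_of_mem_intrinsicInterior (hF : IsFace a F G) (hF' : F' ⊆ G)
    (hz : z ∈ hull a F) (hz' : z ∈ intrinsicInterior ℝ (hull a F')) : F' ⊆ F := by
  obtain ⟨-, f, hf, rfl⟩ := isFace_iff.1 hF
  have hfz : f z = 0 := apply_eq_apply_of_mem_hull (g := 0) (fun j hj => hj.2) hz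
  exact fun i hi => ⟨hF' hi, apply_label_eq_zero_of_mem_intrinsicInterior
    (fun j hj => hf j (hF' hj)) hz' hfz i hi⟩

lemma IsFace.eq_of_mem_intrinsicInterior (hF : IsFace a F G) (hF' : IsFace a F' G)
    (hz : z ∈ intrinsicInterior ℝ (hull a F)) (hz' : z ∈ intrinsicInterior ℝ (hull a F')) :
    F = F' :=
  (hF'.subset_of_mem_intrinsicInterior hF.subset (intrinsicInterior_subset hz') hz).antisymm
    (hF.subset_of_mem_intrinsicInterior hF'.subset (intrinsicInterior_subset hz) hz')

lemma IsSubdivision.isFace_of_mem [Finite ι] (hS : IsSubdivision a S) (hF : F ∈ S) (hG : G ∈ S)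
    (hz : z ∈ intrinsicInterior ℝ (hull a F)) (hz' : z ∈ hull a G) : IsFace a F G := by
  obtain ⟨F', hF', hzF'⟩ := exists_isFace_mem_intrinsicInterior hz'
  suffices F = F' by rwa [this]
  by_contra hne
  exact (hS.disjoint F hF F' (hS.face_mem G hG F' hF') hne).le ⟨hz, hzF'⟩

lemma IsSubdivision.eq_faces [Finite ι] (hS : IsSubdivision a S) (hG : G ∈ S)
    (h : hull a Set.univ ⊆ hull a G) : S = {F | IsFace a F G} := by
  refine Set.Subset.antisymm (fun F hF => ?_) (fun F hF => hS.face_mem G hG F hF)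
  obtain ⟨z, hz⟩ := intrinsicInterior_hull_nonempty (a := a) (hS.nonempty F hF)
  exact hS.isFace_of_mem hF hG hz
    (h (hull_mono (Set.subset_univ F) (intrinsicInterior_subset hz)))

lemma isSubdivision_faces [Finite ι] {M : Set (Set ι)}
    (hcover : hull a Set.univ ⊆ ⋃ G ∈ M, hull a G)
    (hcompat : ∀ G ∈ M, ∀ G' ∈ M, ∀ F F' z, IsFace a F G → IsFace a F' G' →
      z ∈ intrinsicInterior ℝ (hull a F) → z ∈ intrinsicInterior ℝ (hull a F') → F = F') :
    IsSubdivision a {F | ∃ G ∈ M, IsFace a F G} where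
  nonempty _ := fun ⟨_, _, hF⟩ => hF.1
  face_mem _ := fun ⟨G, hG, hF⟩ _ hF' => ⟨G, hG, hF'.trans hF⟩
  cover := by
    refine Set.Subset.antisymm (fun z hz => ?_)
      (Set.iUnion₂_subset fun F _ => hull_mono (Set.subset_univ F))
    obtain ⟨G, hG, hzG⟩ := Set.mem_iUnion₂.1 (hcover hz)
    obtain ⟨F, hF, hzF⟩ := exists_isFace_mem_intrinsicInterior hzG
    exact Set.mem_iUnion₂.2 ⟨F, ⟨G, hG, hF⟩, intrinsicInterior_subset hzF⟩
  disjoint F := fun ⟨G, hG, hF⟩ F' ⟨G', hG', hF'⟩ hne =>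
    Set.eq_empty_of_forall_notMem fun z hz =>
      hne (hcompat G hG G' hG' F F' z hF hF' hz.1 hz.2)

lemma exists_maximalFaces_superset [Finite ι] (hF : F ∈ S) : ∃ G ∈ maximalFaces S, F ⊆ G :=
  ((Set.toFinite S).exists_le_maximal hF).imp fun _ => And.symm

lemma IsSubdivision.exists_maximalFaces_mem_hull [Finite ι] (hS : IsSubdivision a S)
    (hz : z ∈ hull a Set.univ) : ∃ G ∈ maximalFaces S, z ∈ hull a G := by
  rw [hS.cover] at hz
  obtain ⟨F, hF, hzF⟩ := Set.mem_iUnion₂.1 hz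
  obtain ⟨G, hG, hFG⟩ := exists_maximalFaces_superset hF
  exact ⟨G, hG, hull_mono hFG hzF⟩

end Faces

section OneSplits

variable {a : ι → EuclideanSpace ℝ (Fin d)} {S : Set (Set ι)} {p : ι}

lemma IsKSplit.exists_forall_notMem [Finite ι] (hS : IsKSplit a 1 S) : ∃ p, ∀ G ∈ S, p ∉ G := by
  obtain ⟨⟨hsub, hne, -⟩, hcard, -⟩ := hS
  obtain ⟨M, hM⟩ := Set.ncard_eq_one.1 hcard
  have hMS : Maximal (· ∈ S) M := hM.ge rfl
  by_contra! hcon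
  have huniv : M = Set.univ := by
    refine Set.eq_univ_of_forall fun p => ?_
    obtain ⟨G, hG, hp⟩ := hcon p
    obtain ⟨M', hM', hGM'⟩ := exists_maximalFaces_superset hG
    rw [hM, Set.mem_singleton_iff] at hM'
    exact hM' ▸ hGM' hp
  exact hne (hsub.eq_faces (huniv ▸ hMS.1) subset_rfl)

lemma IsSubdivision.mem_hull_compl (hS : IsSubdivision a (pointSplit a p)) :
    a p ∈ hull a {p}ᶜ := by
  have h : a p ∈ hull a Set.univ := mem_hull (Set.mem_univ p)
  rw [hS.cover] at h
  obtain ⟨F, hF, hpF⟩ := Set.mem_iUnion₂.1 h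
  exact hull_mono (IsFace.subset hF) hpF

lemma hull_compl_singleton (hp : a p ∈ hull a {p}ᶜ) : hull a {p}ᶜ = hull a Set.univ := by
  refine (hull_mono (Set.subset_univ _)).antisymm (convexHull_min ?_ convex_hull)
  rintro _ ⟨i, -, rfl⟩
  by_cases h : i = p
  · rwa [h]
  · exact mem_hull h

lemma isCoarsest_pointSplit [Finite ι] (hp : a p ∈ hull a {p}ᶜ) :
    IsCoarsest a (pointSplit a p) := by
  have hcover := hull_compl_singleton hp
  have hmem : {p}ᶜ ∈ pointSplit a p := IsFace.refl (hull_nonempty.1 ⟨_, hp⟩)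
  refine ⟨?_, fun h => ?_, fun T hT href => ?_⟩
  · have := isSubdivision_faces (a := a) (M := {{p}ᶜ}) (by simp [hcover])
      (by rintro _ rfl _ rfl F F' z; exact IsFace.eq_of_mem_intrinsicInterior)
    simpa only [Set.mem_singleton_iff, exists_eq_left, pointSplit] using this
  · have huniv : Set.univ ∈ pointSplit a p := h ▸ IsFace.refl ⟨p, Set.mem_univ p⟩
    exact IsFace.subset huniv (Set.mem_univ p) rfl
  · obtain ⟨G, hG, hle⟩ := href _ hmem
    by_cases hpG : p ∈ G
    · obtain rfl : G = Set.univ := Set.eq_univ_of_forall fun i =>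
        (eq_or_ne i p).elim (fun h => h ▸ hpG) fun h => hle h
      exact Or.inr (hT.eq_faces hG subset_rfl)
    · obtain rfl : G = {p}ᶜ := (Set.subset_compl_singleton_iff.2 hpG).antisymm hle
      exact Or.inl (hT.eq_faces hG hcover.ge)

lemma isKSplit_pointSplit [Finite ι] (ha : affineSpan ℝ (Set.range a) = ⊤)
    (hp : a p ∈ hull a {p}ᶜ) : IsKSplit a 1 (pointSplit a p) := by
  have hcover := hull_compl_singleton hp
  have hmem : {p}ᶜ ∈ pointSplit a p := IsFace.refl (hull_nonempty.1 ⟨_, hp⟩)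
  have hmax : maximalFaces (pointSplit a p) = {{p}ᶜ} :=
    Set.ext fun F => ⟨fun hF => hF.eq_of_le hmem (IsFace.subset hF.1), by
      rintro rfl
      exact ⟨hmem, fun F hF _ => IsFace.subset hF⟩⟩
  refine ⟨isCoarsest_pointSplit hp, by rw [hmax, Set.ncard_singleton], _, hmem, fun h => ?_, ?_⟩
  · obtain ⟨z, hz⟩ := interior_hull_nonempty (F := Set.univ) (Set.image_univ ▸ ha)
    exact (h (hcover.ge (interior_subset hz))).2 hz
  · have hspan : affineSpan ℝ (a '' {p}ᶜ) = ⊤ := by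
      rw [← affineSpan_convexHull, ← hull, hcover, hull, affineSpan_convexHull, Set.image_univ, ha]
    rw [← direction_affineSpan, hspan, AffineSubspace.direction_top, finrank_top,
      finrank_euclideanSpace_fin]

end OneSplits

/-! ### Two-splits -/

section TwoSplits

variable {a : ι → EuclideanSpace ℝ (Fin d)} {S S' : Set (Set ι)} {F P : Set ι}
  {z : EuclideanSpace ℝ (Fin d)} {h h' : ℝ × EuclideanSpace ℝ (Fin d)}

lemma eventually_forall_mem_hull_imp [Finite ι] (a : ι → EuclideanSpace ℝ (Fin d))
    (z : EuclideanSpace ℝ (Fin d)) : ∀ᶠ y in 𝓝 z, ∀ G, y ∈ hull a G → z ∈ hull a G := by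
  refine Filter.eventually_all.2 fun G => ?_
  by_cases hz : z ∈ hull a G
  · exact Filter.Eventually.of_forall fun _ _ => hz
  · filter_upwards [isClosed_hull.isOpen_compl.mem_nhds hz] with y hy hyG using absurd hyG hy

lemma IsSubdivision.exists_maximalFaces_nonpos [Finite ι] (hS : IsSubdivision a S) (hF : F ∈ S)
    (hz : z ∈ intrinsicInterior ℝ (hull a F)) (hzi : z ∈ interior (hull a Set.univ))
    (hspan : ∀ y, y ∈ affineSpan ℝ (a '' F) ↔ toAffine h y = 0) (hh : h.2 ≠ 0) :
    ∃ M ∈ maximalFaces S, M ⊆ {i | toAffine h (a i) ≤ 0} ∧ ∃ i ∈ M, toAffine h (a i) < 0 := by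
  have hF0 (i : ι) (hi : i ∈ F) : toAffine h (a i) = 0 :=
    (hspan _).1 (subset_affineSpan ℝ _ ⟨i, hi, rfl⟩)
  have hlim : Filter.Tendsto (fun t : ℝ => z + t • h.2) (𝓝[>] 0) (𝓝 z) := by
    have : Continuous fun t : ℝ => z + t • h.2 := by fun_prop
    simpa using (this.tendsto 0).mono_left nhdsWithin_le_nhds
  obtain ⟨t, ⟨htC, htz⟩, ht⟩ := ((hlim.eventually (Filter.Eventually.and
    (mem_interior_iff_mem_nhds.1 hzi) (eventually_forall_mem_hull_imp a z))).and
    self_mem_nhdsWithin).exists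
  have hneg : toAffine h (z + t • h.2) < 0 := by
    have hz0 : toAffine h z = 0 :=
      apply_eq_apply_of_mem_hull (g := 0) hF0 (intrinsicInterior_subset hz)
    rw [toAffine_add_right, hz0, inner_smul_left, zero_sub, neg_lt_zero]
    exact mul_pos ht (real_inner_self_pos.2 hh)
  obtain ⟨M, hM, hyM⟩ := hS.exists_maximalFaces_mem_hull htC
  obtain ⟨i, hiM, hi⟩ : ∃ i ∈ M, toAffine h (a i) < 0 := by
    by_contra! hcon
    exact (apply_nonneg_of_mem_hull hcon hyM).not_gt hneg
  obtain ⟨-, f, hf, hFf⟩ := isFace_iff.1 (hS.isFace_of_mem hF hM.1 hz (htz M hyM))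
  obtain ⟨c, rfl⟩ : ∃ c : ℝ, f = c • toAffine h := by
    refine exists_eq_smul_of_forall_eq_zero (toAffine_linear_ne_zero hh) fun y hy => ?_
    refine AffineMap.eqOn_affineSpan (g := 0) ?_ ((hspan y).2 hy)
    rintro _ ⟨j, hj, rfl⟩
    exact (hFf.le hj).2
  simp only [AffineMap.coe_smul, Pi.smul_apply, smul_eq_mul] at hf hFf
  have hc : 0 < c := by
    have hle := apply_nonpos_of_mem_hull (f := c • toAffine h) hf hyM
    refine (nonneg_of_mul_nonpos_left hle hneg).lt_of_ne ?_
    rintro rfl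
    exact hi.ne (hF0 i (hFf ▸ ⟨hiM, zero_mul _⟩))
  exact ⟨M, hM, fun j hj => nonpos_of_mul_nonpos_right (hf j hj) hc, i, hiM, hi⟩

/-- The faces of the two sides of the hyperplane on which `h` vanishes. For a suitable `h` this
is the `2`-split with this hyperplane. -/
def sides (a : ι → EuclideanSpace ℝ (Fin d)) (h : ℝ × EuclideanSpace ℝ (Fin d)) : Set (Set ι) :=
  {F | IsFace a F {i | 0 ≤ toAffine h (a i)} ∨ IsFace a F {i | toAffine h (a i) ≤ 0}}

lemma sides_neg : sides a (-h) = sides a h := by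
  simp [sides, or_comm]

lemma sides_smul {c : ℝ} (hc : c ≠ 0) : sides a (c • h) = sides a h := by
  have hpos {c : ℝ} (hc : 0 < c) : sides a (c • h) = sides a h := by
    have hle (r : ℝ) : c * r ≤ 0 ↔ r ≤ 0 :=
      ⟨fun hr => nonpos_of_mul_nonpos_right hr hc, mul_nonpos_of_nonneg_of_nonpos hc.le⟩
    simp [sides, mul_nonneg_iff_of_pos_left hc, hle]
  rcases hc.lt_or_gt with hc | hc
  · rw [← hpos (neg_pos.2 hc), neg_smul, sides_neg]
  · exact hpos hc

lemma isSubdivision_sides [Finite ι]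
    (hcover : hull a Set.univ ⊆
      hull a {i | 0 ≤ toAffine h (a i)} ∪ hull a {i | toAffine h (a i) ≤ 0}) :
    IsSubdivision a (sides a h) := by
  have hcross {F F' : Set ι} {z : EuclideanSpace ℝ (Fin d)}
      (hF : IsFace a F {i | 0 ≤ toAffine h (a i)}) (hF' : IsFace a F' {i | toAffine h (a i) ≤ 0})
      (hz : z ∈ intrinsicInterior ℝ (hull a F)) (hz' : z ∈ intrinsicInterior ℝ (hull a F')) :
      F = F' := by
    have hz0 : toAffine h z = 0 :=
      (apply_nonpos_of_mem_hull hF'.subset (intrinsicInterior_subset hz')).antisymm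
        (apply_nonneg_of_mem_hull hF.subset (intrinsicInterior_subset hz))
    have hF0 : F ⊆ {i | toAffine h (a i) = 0} := fun i hi =>
      neg_eq_zero.1 (apply_label_eq_zero_of_mem_intrinsicInterior (f := -toAffine h)
        (fun j hj => neg_nonpos.2 (hF.subset hj)) hz (neg_eq_zero.2 hz0) i hi)
    have hF0' : F' ⊆ {i | toAffine h (a i) = 0} :=
      apply_label_eq_zero_of_mem_intrinsicInterior hF'.subset hz' hz0
    exact (hF.of_subset hF0 fun i hi => hi.ge).eq_of_mem_intrinsicInterior
      (hF'.of_subset hF0' fun i hi => hi.le) hz hz'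
  have hsub := isSubdivision_faces
    (M := {{i | 0 ≤ toAffine h (a i)}, {i | toAffine h (a i) ≤ 0}})
    (by rwa [Set.biUnion_pair]) (by
      rintro G (rfl | rfl) G' (rfl | rfl) F F' z hF hF' hz hz'
      · exact hF.eq_of_mem_intrinsicInterior hF' hz hz'
      · exact hcross hF hF' hz hz'
      · exact (hcross hF' hF hz' hz).symm
      · exact hF.eq_of_mem_intrinsicInterior hF' hz hz')
  simpa only [Set.mem_insert_iff, Set.mem_singleton_iff, exists_eq_or_imp, exists_eq_left, sides]
    using hsub

lemma univ_notMem_sides (hpos : ∃ i, 0 < toAffine h (a i)) (hneg : ∃ i, toAffine h (a i) < 0) :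
    Set.univ ∉ sides a h := by
  obtain ⟨⟨p, hp⟩, q, hq⟩ := And.intro hpos hneg
  rintro (h | h)
  · exact hq.not_ge (h.subset (Set.mem_univ q))
  · exact hp.not_ge (h.subset (Set.mem_univ p))

lemma maximalFaces_sides (hpos : ∃ i, 0 < toAffine h (a i)) (hneg : ∃ i, toAffine h (a i) < 0) :
    maximalFaces (sides a h) = {{i | 0 ≤ toAffine h (a i)}, {i | toAffine h (a i) ≤ 0}} := by
  obtain ⟨⟨p, hp⟩, q, hq⟩ := And.intro hpos hneg
  have hP : {i | 0 ≤ toAffine h (a i)} ∈ sides a h := Or.inl (IsFace.refl ⟨p, hp.le⟩)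
  have hQ : {i | toAffine h (a i) ≤ 0} ∈ sides a h := Or.inr (IsFace.refl ⟨q, hq.le⟩)
  refine Set.Subset.antisymm (fun M hM => ?_) ?_
  · exact hM.1.imp (fun hMP => hM.eq_of_le hP hMP.subset) fun hMQ => hM.eq_of_le hQ hMQ.subset
  · rintro M (rfl | rfl)
    · refine ⟨hP, fun G hG hle => hG.elim IsFace.subset fun hG' => ?_⟩
      exact absurd (hG'.subset (hle hp.le)) hp.not_ge
    · refine ⟨hQ, fun G hG hle => hG.elim (fun hG' => ?_) IsFace.subset⟩
      exact absurd (hG'.subset (hle hq.le)) hq.not_ge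

/-- `h` is a normalized affine functional whose zero set is the hyperplane of the `2`-split `S`. -/
structure IsSplitFunctional (a : ι → EuclideanSpace ℝ (Fin d)) (S : Set (Set ι))
    (h : ℝ × EuclideanSpace ℝ (Fin d)) : Prop where
  norm_eq : ‖h.2‖ = 1
  eq_sides : S = sides a h
  cover : hull a Set.univ ⊆ hull a {i | 0 ≤ toAffine h (a i)} ∪ hull a {i | toAffine h (a i) ≤ 0}
  exists_pos : ∃ i, 0 < toAffine h (a i)
  exists_neg : ∃ i, toAffine h (a i) < 0
  mem_hyperplane_iff : ∀ y, y ∈ splitHyperplane a S ↔ toAffine h y = 0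

lemma IsSplitFunctional.neg (hS : IsSplitFunctional a S h) : IsSplitFunctional a S (-h) where
  norm_eq := by rw [Prod.snd_neg, norm_neg, hS.norm_eq]
  eq_sides := by rw [sides_neg, hS.eq_sides]
  cover := by simpa [Set.union_comm] using hS.cover
  exists_pos := by simpa using hS.exists_neg
  exists_neg := by simpa using hS.exists_pos
  mem_hyperplane_iff y := by simp [hS.mem_hyperplane_iff]

lemma IsSplitFunctional.maximalFaces_eq (hS : IsSplitFunctional a S h) :
    maximalFaces S = {{i | 0 ≤ toAffine h (a i)}, {i | toAffine h (a i) ≤ 0}} := by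
  rw [hS.eq_sides, maximalFaces_sides hS.exists_pos hS.exists_neg]

lemma IsSplitFunctional.eq_of_smul {c : ℝ} (hS : IsSplitFunctional a S h)
    (hS' : IsSplitFunctional a S' (c • h)) : S = S' := by
  rw [hS.eq_sides, hS'.eq_sides, sides_smul]
  rintro rfl
  simpa using hS'.norm_eq

lemma IsSubdivision.exists_maximalFaces_eq_pair [Finite ι] (hS : IsSubdivision a S)
    (hcard : (maximalFaces S).ncard = 2) (hF : F ∈ S) (hFi : IsInterior a F)
    (hspan : ∀ y, y ∈ affineSpan ℝ (a '' F) ↔ toAffine h y = 0) (hh : h.2 ≠ 0) :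
    ∃ P Q, maximalFaces S = {P, Q} ∧ P ⊆ {i | 0 ≤ toAffine h (a i)} ∧
      Q ⊆ {i | toAffine h (a i) ≤ 0} ∧ (∃ i, 0 < toAffine h (a i)) ∧
      ∃ i, toAffine h (a i) < 0 := by
  obtain ⟨z, hz⟩ := intrinsicInterior_hull_nonempty (a := a) (hS.nonempty F hF)
  have hzi := mem_interior_of_mem_intrinsicInterior convex_hull
    (hull_mono (Set.subset_univ F)) hFi hz
  obtain ⟨Q, hQS, hQ, q, hqQ, hq⟩ := hS.exists_maximalFaces_nonpos hF hz hzi hspan hh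
  obtain ⟨P, hPS, hP, p, -, hp⟩ := hS.exists_maximalFaces_nonpos (h := -h) hF hz hzi
    (by simpa using hspan) (neg_ne_zero.2 hh)
  simp only [map_neg, AffineMap.coe_neg, Pi.neg_apply, Left.neg_nonpos_iff, Left.neg_neg_iff]
    at hP hp
  have hPQ : P ≠ Q := by
    rintro rfl
    exact (hP hqQ).not_gt hq
  have hmax := Set.eq_of_subset_of_ncard_le (Set.pair_subset hPS hQS)
    (by rw [hcard, Set.ncard_pair hPQ])
  exact ⟨P, Q, hmax.symm, hP, hQ, ⟨p, hp⟩, q, hq⟩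

lemma IsCoarsest.eq_sides [Finite ι] (hS : IsCoarsest a S)
    (hle : ∀ M ∈ maximalFaces S, M ⊆ {i | 0 ≤ toAffine h (a i)} ∨ M ⊆ {i | toAffine h (a i) ≤ 0})
    (hpos : ∃ i, 0 < toAffine h (a i)) (hneg : ∃ i, toAffine h (a i) < 0)
    (hcover : hull a Set.univ ⊆
      hull a {i | 0 ≤ toAffine h (a i)} ∪ hull a {i | toAffine h (a i) ≤ 0}) :
    S = sides a h := by
  refine ((hS.2.2 _ (isSubdivision_sides hcover) fun G hG => ?_).resolve_right fun htriv => ?_).symm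
  · obtain ⟨M, hM, hGM⟩ := exists_maximalFaces_superset hG
    have hmax := maximalFaces_sides hpos hneg
    rcases hle M hM with hM | hM
    · exact ⟨_, (hmax.ge (Or.inl rfl)).1, hGM.trans hM⟩
    · exact ⟨_, (hmax.ge (Or.inr rfl)).1, hGM.trans hM⟩
  · exact univ_notMem_sides hpos hneg
      (htriv.ge (IsFace.refl (hpos.imp fun p _ => Set.mem_univ p)))

lemma IsKSplit.exists_isSplitFunctional [Finite ι] (hS : IsKSplit a 2 S) :
    ∃ h, IsSplitFunctional a S h := by
  obtain ⟨hc, hcard, F, hF, hFi, hfr⟩ := hS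
  obtain ⟨h, hnorm, hspan⟩ := exists_mem_iff_toAffine_eq_zero (V := affineSpan ℝ (a '' F))
    (((hc.1.nonempty F hF).image a).affineSpan ℝ) (by
      rw [direction_affineSpan, finrank_euclideanSpace_fin]
      exact Nat.succ.inj hfr)
  obtain ⟨P, Q, hmax, hP, hQ, hpos, hneg⟩ := hc.1.exists_maximalFaces_eq_pair hcard hF hFi hspan
    (norm_ne_zero_iff.1 (hnorm.trans_ne one_ne_zero))
  have hle : ∀ M ∈ maximalFaces S,
      M ⊆ {i | 0 ≤ toAffine h (a i)} ∨ M ⊆ {i | toAffine h (a i) ≤ 0} := by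
    rw [hmax]
    rintro M (rfl | rfl)
    exacts [Or.inl hP, Or.inr hQ]
  have hcover : hull a Set.univ ⊆
      hull a {i | 0 ≤ toAffine h (a i)} ∪ hull a {i | toAffine h (a i) ≤ 0} := fun y hy => by
    obtain ⟨M, hM, hyM⟩ := hc.1.exists_maximalFaces_mem_hull hy
    exact (hle M hM).imp (fun h => hull_mono h hyM) fun h => hull_mono h hyM
  have hsides := hc.eq_sides hle hpos hneg hcover
  refine ⟨h, hnorm, hsides, hcover, hpos, hneg, fun y => ⟨fun hy => ?_, fun hy => ?_⟩⟩
  · refine AffineMap.eqOn_affineSpan (f := toAffine h) (g := 0) ?_ hy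
    rintro _ ⟨i, hi, rfl⟩
    exact (hQ (hi Q (hmax.ge (Or.inr rfl)))).antisymm (hP (hi P (hmax.ge (Or.inl rfl))))
  · refine affineSpan_mono ℝ (Set.image_mono fun i hi => ?_) ((hspan y).2 hy)
    have hi0 : toAffine h (a i) = 0 := (hspan _).1 (subset_affineSpan ℝ _ ⟨i, hi, rfl⟩)
    rw [hsides, maximalFaces_sides hpos hneg]
    rintro M (rfl | rfl)
    exacts [hi0.ge, hi0.le]

lemma IsKSplit.exists_isSplitFunctional_of_mem [Finite ι] (hS : IsKSplit a 2 S)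
    (hP : P ∈ maximalFaces S) :
    ∃ h, IsSplitFunctional a S h ∧ P = {i | 0 ≤ toAffine h (a i)} := by
  obtain ⟨h, hh⟩ := hS.exists_isSplitFunctional
  rcases hh.maximalFaces_eq.le hP with rfl | rfl
  · exact ⟨h, hh, rfl⟩
  · exact ⟨-h, hh.neg, by simp⟩

/-- The weight function of a `2`-split with the functional `h`, see
`IsSplitFunctional.splitWeight_eq`. -/
def posWeight (a : ι → EuclideanSpace ℝ (Fin d)) (h : ℝ × EuclideanSpace ℝ (Fin d)) : ι → ℝ :=
  fun i => max (toAffine h (a i)) 0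

lemma IsSplitFunctional.splitWeight_eq (hS : IsSplitFunctional a S h) :
    splitWeight a S {i | 0 ≤ toAffine h (a i)} = posWeight a h := by
  ext i
  rw [splitWeight, posWeight, Set.indicator_apply]
  split_ifs with hi
  · rw [infDist_eq_abs_toAffine hS.norm_eq hS.mem_hyperplane_iff, abs_of_nonneg hi,
      max_eq_left hi]
  · exact (max_eq_right (not_le.1 hi).le).symm

end TwoSplits

/-! ### Envelopes -/

section Envelopes

variable {a : ι → EuclideanSpace ℝ (Fin d)} {w w' : ι → ℝ} {x x' m : ℝ × EuclideanSpace ℝ (Fin d)}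

/-- The labels at which the affine minorant `x` of `w` attains `w`. For `x` in the envelope these
are the labels of a face of the regular subdivision of `w`. -/
def tight (a : ι → EuclideanSpace ℝ (Fin d)) (w : ι → ℝ) (x : ℝ × EuclideanSpace ℝ (Fin d)) :
    Set ι :=
  {i | toAffine x (a i) = w i}

lemma mem_envelope : x ∈ envelope a w ↔ ∀ i, toAffine x (a i) ≤ w i :=
  forall_congr' fun i => by rw [toAffine_apply, neg_le]

lemma add_mem_envelope (hx : x ∈ envelope a w) (hx' : x' ∈ envelope a w') :
    x + x' ∈ envelope a (w + w') := by
  rw [mem_envelope] at *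
  intro i
  rw [map_add]
  exact add_le_add (hx i) (hx' i)

lemma convex_envelope : Convex ℝ (envelope a w) := by
  intro x hx x' hx' s t hs ht hst
  rw [mem_envelope] at *
  intro i
  have hconv := convex_Iic (w i) (hx i) (hx' i) hs ht hst
  simpa using hconv

lemma envelope_nonempty [Finite ι] : (envelope a w).Nonempty := by
  obtain ⟨M, hM⟩ := (Set.finite_range fun i => -w i).bddAbove
  refine ⟨(M, 0), fun i => ?_⟩
  simpa using hM ⟨i, rfl⟩

lemma envelope_add_zero : envelope a w + envelope a 0 = envelope a w := by
  refine Set.Subset.antisymm ?_ fun x hx => ⟨x, hx, 0, ?_, add_zero x⟩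
  · rintro _ ⟨x, hx, z, hz, rfl⟩
    simpa using add_mem_envelope hx hz
  · simp [mem_envelope]

/-- The vertices of the envelope of `w`, as the affine minorants of `w` that are tight at labels
whose points span the whole space. -/
def vertices (a : ι → EuclideanSpace ℝ (Fin d)) (w : ι → ℝ) :
    Set (ℝ × EuclideanSpace ℝ (Fin d)) :=
  {x ∈ envelope a w | affineSpan ℝ (a '' tight a w x) = ⊤}

lemma eq_zero_of_affineSpan_eq_top {T : Set ι} (hT : affineSpan ℝ (a '' T) = ⊤)
    (hm : ∀ i ∈ T, toAffine m (a i) = 0) : m = 0 :=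
  affineSpan_eq_top_iff_forall_toAffine.1 hT m (Set.forall_mem_image.2 hm)

lemma finite_vertices [Finite ι] : (vertices a w).Finite := by
  refine Set.Finite.of_finite_image (f := tight a w) (Set.toFinite _) fun x hx x' _ h => ?_
  refine sub_eq_zero.1 (eq_zero_of_affineSpan_eq_top hx.2 fun i hi => ?_)
  rw [map_sub]
  exact sub_eq_zero.2 (hi.trans (h.le hi).symm)

lemma exists_toAffine_eq_zero_and_pos (ha : affineSpan ℝ (Set.range a) = ⊤) {T : Set ι}
    (hT : affineSpan ℝ (a '' T) ≠ ⊤) :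
    ∃ m : ℝ × EuclideanSpace ℝ (Fin d),
      (∀ i ∈ T, toAffine m (a i) = 0) ∧ ∃ i, 0 < toAffine m (a i) := by
  rw [Ne, affineSpan_eq_top_iff_forall_toAffine] at hT
  push Not at hT
  obtain ⟨m, hm, hm0⟩ := hT
  rw [Set.forall_mem_image] at hm
  obtain ⟨i, hi⟩ : ∃ i, toAffine m (a i) ≠ 0 := by
    by_contra! hcon
    exact hm0 (affineSpan_eq_top_iff_forall_toAffine.1 ha m (Set.forall_mem_range.2 hcon))
  rcases hi.lt_or_gt with hi | hi
  · exact ⟨-m, fun j hj => by simp [hm hj], i, by simpa using hi⟩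
  · exact ⟨m, fun j hj => hm hj, i, hi⟩

lemma exists_tight_ssubset [Finite ι] (hx : x ∈ envelope a w)
    (hm : ∀ i ∈ tight a w x, toAffine m (a i) = 0) (hpos : ∃ i, 0 < toAffine m (a i)) :
    ∃ t > (0 : ℝ), x + t • m ∈ envelope a w ∧ tight a w x ⊂ tight a w (x + t • m) := by
  rw [mem_envelope] at hx
  obtain ⟨j, hj, hmin⟩ := Set.exists_min_image {i | 0 < toAffine m (a i)}
    (fun i => (w i - toAffine x (a i)) / toAffine m (a i)) (Set.toFinite _) hpos
  have hjx : toAffine x (a j) < w j := (hx j).lt_of_ne fun h => hj.ne' (hm j h)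
  have ht := div_pos (sub_pos.2 hjx) hj
  refine ⟨_, ht, mem_envelope.2 fun i => ?_, ?_⟩
  · rw [toAffine_add_smul]
    rcases lt_or_ge 0 (toAffine m (a i)) with hi | hi
    · exact le_sub_iff_add_le'.1 ((le_div_iff₀ hi).1 (hmin i hi))
    · exact (add_le_of_nonpos_right (mul_nonpos_of_nonneg_of_nonpos ht.le hi)).trans (hx i)
  · refine (Set.ssubset_iff_of_subset fun i hi => ?_).2 ⟨j, ?_, hjx.ne⟩
    · exact (toAffine_add_smul _ _ _ _).trans (by rw [hm i hi, mul_zero, add_zero, hi])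
    · refine (toAffine_add_smul _ _ _ _).trans ?_
      rw [div_mul_cancel₀ _ hj.ne', add_sub_cancel]

lemma envelope_subset_of_convex [Finite ι] (ha : affineSpan ℝ (Set.range a) = ⊤)
    {K : Set (ℝ × EuclideanSpace ℝ (Fin d))} (hK : Convex ℝ K) (hV : vertices a w ⊆ K)
    (h0 : K + envelope a 0 ⊆ K) : envelope a w ⊆ K := by
  intro x hx
  induction hn : (tight a w x)ᶜ.ncard using Nat.strong_induction_on generalizing x with
  | _ n ih =>
  subst hn
  by_cases hs : affineSpan ℝ (a '' tight a w x) = ⊤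
  · exact hV ⟨hx, hs⟩
  have hmove {m : ℝ × EuclideanSpace ℝ (Fin d)} (hm : ∀ i ∈ tight a w x, toAffine m (a i) = 0)
      (hpos : ∃ i, 0 < toAffine m (a i)) : ∃ t > (0 : ℝ), x + t • m ∈ K := by
    obtain ⟨t, ht, hxt, hlt⟩ := exists_tight_ssubset hx hm hpos
    exact ⟨t, ht, ih _ (Set.ncard_lt_ncard (compl_lt_compl_iff_lt.2 hlt)) hxt rfl⟩
  obtain ⟨m, hm, hpos⟩ := exists_toAffine_eq_zero_and_pos ha hs
  obtain ⟨t, ht, htK⟩ := hmove hm hpos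
  by_cases hneg : ∃ i, 0 < toAffine (-m) (a i)
  · obtain ⟨s, hs, hsK⟩ := hmove (m := -m) (fun i hi => by simp [hm i hi]) hneg
    have hline : Convex ℝ {r : ℝ | AffineMap.lineMap x (x + m) r ∈ K} :=
      hK.affine_preimage (AffineMap.lineMap x (x + m))
    have hmem := hline.ordConnected.out (x := -s) (y := t)
      (by simpa [AffineMap.lineMap_apply, add_comm] using hsK)
      (by simpa [AffineMap.lineMap_apply, add_comm] using htK)
      (show (0 : ℝ) ∈ Set.Icc (-s) t from ⟨(neg_neg_of_pos hs).le, ht.le⟩)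
    simpa using hmem
  · have hrec : t • -m ∈ envelope a 0 := mem_envelope.2 fun i => by
      rw [map_smul]
      exact mul_nonpos_of_nonneg_of_nonpos ht.le (not_lt.1 fun hi => hneg ⟨i, hi⟩)
    simpa using h0 (Set.add_mem_add htK hrec)

lemma exists_mem_vertices [Finite ι] (ha : affineSpan ℝ (Set.range a) = ⊤)
    (hx : x ∈ envelope a w) : ∃ y ∈ vertices a w, tight a w x ⊆ tight a w y := by
  induction hn : (tight a w x)ᶜ.ncard using Nat.strong_induction_on generalizing x with
  | _ n ih =>
  subst hn
  by_cases hs : affineSpan ℝ (a '' tight a w x) = ⊤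
  · exact ⟨x, ⟨hx, hs⟩, subset_rfl⟩
  obtain ⟨m, hm, hpos⟩ := exists_toAffine_eq_zero_and_pos ha hs
  obtain ⟨t, -, hxt, hlt⟩ := exists_tight_ssubset hx hm hpos
  obtain ⟨y, hy, hty⟩ := ih _ (Set.ncard_lt_ncard (compl_lt_compl_iff_lt.2 hlt)) hxt rfl
  exact ⟨y, hy, hlt.subset.trans hty⟩

lemma vertices_nonempty [Finite ι] (ha : affineSpan ℝ (Set.range a) = ⊤) :
    (vertices a w).Nonempty :=
  (exists_mem_vertices ha envelope_nonempty.some_mem).imp fun _ => And.left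

lemma zero_mem_envelope_smul_posWeight {c : ℝ} (hc : 0 ≤ c) :
    0 ∈ envelope a (c • posWeight a m) :=
  mem_envelope.2 fun i => by simpa [posWeight] using mul_nonneg hc (le_max_right _ _)

lemma smul_mem_envelope_smul_posWeight {c : ℝ} (hc : 0 ≤ c) :
    c • m ∈ envelope a (c • posWeight a m) :=
  mem_envelope.2 fun i => by
    simpa [posWeight] using mul_le_mul_of_nonneg_left (le_max_left _ _) hc

end Envelopes

/-! ### Lower hulls -/

lemma isLUB_sum {κ : Type*} {s : Finset κ} {K : κ → Set ℝ} {r : κ → ℝ}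
    (h : ∀ k ∈ s, IsLUB (K k) (r k)) : IsLUB (∑ k ∈ s, K k) (∑ k ∈ s, r k) := by
  classical
  induction s using Finset.induction_on with
  | empty => simp [isLUB_singleton (a := (0 : ℝ)), ← Set.singleton_zero]
  | insert k s hk ih =>
    rw [Finset.sum_insert hk, Finset.sum_insert hk]
    rw [Finset.forall_mem_insert] at h
    exact h.1.add (ih h.2)

section LowerHull

variable {a : ι → EuclideanSpace ℝ (Fin d)} {u v w : ι → ℝ}
  {x : ℝ × EuclideanSpace ℝ (Fin d)} {y : EuclideanSpace ℝ (Fin d)}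

/-- The largest convex function on `conv A` that is at most `w` on the configuration, as the
supremum of the affine minorants of `w`. Outside `conv A` this is the supremum of an unbounded set
and hence `0`. -/
def lowerHull (a : ι → EuclideanSpace ℝ (Fin d)) (w : ι → ℝ) (y : EuclideanSpace ℝ (Fin d)) : ℝ :=
  sSup ((fun x => toAffine x y) '' envelope a w)

lemma isLUB_lowerHull [Finite ι] (hy : y ∈ hull a Set.univ) :
    IsLUB ((fun x => toAffine x y) '' envelope a w) (lowerHull a w y) := by
  obtain ⟨M, hM⟩ := (Set.finite_range w).bddAbove
  refine isLUB_csSup (envelope_nonempty.image _) ⟨M, Set.forall_mem_image.2 fun x hx => ?_⟩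
  exact apply_le_apply_of_mem_hull (g := AffineMap.const ℝ _ M)
    (fun i _ => (mem_envelope.1 hx i).trans (hM ⟨i, rfl⟩)) hy

lemma toAffine_le_lowerHull [Finite ι] (hx : x ∈ envelope a w) (hy : y ∈ hull a Set.univ) :
    toAffine x y ≤ lowerHull a w y :=
  (isLUB_lowerHull hy).1 ⟨x, hx, rfl⟩

lemma lowerHull_le [Finite ι] {r : ℝ} (h : ∀ x ∈ envelope a w, toAffine x y ≤ r) :
    lowerHull a w y ≤ r :=
  csSup_le (envelope_nonempty.image _) (Set.forall_mem_image.2 h)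

lemma lowerHull_apply_le [Finite ι] (i : ι) : lowerHull a w (a i) ≤ w i :=
  lowerHull_le fun _ hx => mem_envelope.1 hx i

lemma lowerHull_eq_of_mem_hull_tight [Finite ι] (hx : x ∈ envelope a w)
    (hy : y ∈ hull a (tight a w x)) : lowerHull a w y = toAffine x y := by
  refine le_antisymm (lowerHull_le fun x' hx' => ?_)
    (toAffine_le_lowerHull hx (hull_mono (Set.subset_univ _) hy))
  exact apply_le_apply_of_mem_hull (fun i hi => (mem_envelope.1 hx' i).trans hi.ge) hy

lemma convexOn_lowerHull [Finite ι] : ConvexOn ℝ (hull a Set.univ) (lowerHull a w) := by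
  refine ⟨convex_hull, fun y hy y' hy' s t hs ht hst => lowerHull_le fun x hx => ?_⟩
  rw [Convex.combo_affine_apply hst]
  gcongr
  exacts [toAffine_le_lowerHull hx hy, toAffine_le_lowerHull hx hy']

lemma lowerHull_congr (h : envelope a v = envelope a w) : lowerHull a v = lowerHull a w := by
  unfold lowerHull
  rw [h]

lemma lowerHull_of_envelope_eq_add_sum [Finite ι] {κ : Type*} {s : Finset κ} {v : κ → ι → ℝ}
    (h : envelope a w = envelope a u + ∑ k ∈ s, envelope a (v k)) (hy : y ∈ hull a Set.univ) :
    lowerHull a w y = lowerHull a u y + ∑ k ∈ s, lowerHull a (v k) y := by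
  let eval : (ℝ × EuclideanSpace ℝ (Fin d)) →+ ℝ := ⟨⟨fun x => toAffine x y, by simp⟩, by simp⟩
  have hw : IsLUB (eval '' envelope a w) (lowerHull a w y) := isLUB_lowerHull hy
  rw [h, Set.image_add, Set.image_finsetSum] at hw
  exact hw.unique ((isLUB_lowerHull hy).add (isLUB_sum fun k _ => isLUB_lowerHull hy))

lemma exists_mem_vertices_lowerHull_eq [Finite ι] (ha : affineSpan ℝ (Set.range a) = ⊤)
    (hy : y ∈ hull a Set.univ) : ∃ x ∈ vertices a w, lowerHull a w y = toAffine x y := by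
  obtain ⟨x, hx, hmax⟩ := Set.exists_max_image _ (fun x => toAffine x y)
    (finite_vertices (a := a) (w := w)) (vertices_nonempty ha)
  refine ⟨x, hx, (lowerHull_le fun x' hx' => ?_).antisymm (toAffine_le_lowerHull hx.1 hy)⟩
  refine envelope_subset_of_convex ha (K := {x' | toAffine x' y ≤ toAffine x y}) ?_ hmax ?_ hx'
  · intro p hp q hq s t hs ht hst
    simpa using convex_Iic (toAffine x y) hp hq hs ht hst
  · rintro _ ⟨p, hp, z, hz, rfl⟩
    have hzy : toAffine z y ≤ 0 := apply_nonpos_of_mem_hull (fun i _ => mem_envelope.1 hz i) hy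
    simpa using add_le_add hp hzy

/-- Every point of the configuration, lifted by its weight, lies on the lower hull. -/
def IsSupported (a : ι → EuclideanSpace ℝ (Fin d)) (w : ι → ℝ) : Prop :=
  ∀ i, ∃ x ∈ envelope a w, i ∈ tight a w x

lemma IsSupported.lowerHull_apply [Finite ι] (hw : IsSupported a w) (i : ι) :
    lowerHull a w (a i) = w i := by
  obtain ⟨x, hx, hi⟩ := hw i
  exact (lowerHull_eq_of_mem_hull_tight hx (mem_hull hi)).trans hi

lemma exists_isSupported_envelope_eq [Finite ι] (ha : affineSpan ℝ (Set.range a) = ⊤)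
    (w : ι → ℝ) : ∃ v, IsSupported a v ∧ envelope a v = envelope a w ∧ v ≤ w := by
  have hmem (i : ι) : a i ∈ hull a Set.univ := mem_hull (Set.mem_univ i)
  have henv : envelope a (fun i => lowerHull a w (a i)) = envelope a w := by
    ext x
    exact ⟨fun hx => mem_envelope.2 fun i => (mem_envelope.1 hx i).trans (lowerHull_apply_le i),
      fun hx => mem_envelope.2 fun i => toAffine_le_lowerHull hx (hmem i)⟩
  refine ⟨_, fun i => ?_, henv, lowerHull_apply_le⟩
  obtain ⟨x, hx, hxi⟩ := exists_mem_vertices_lowerHull_eq (w := w) ha (hmem i)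
  exact ⟨x, henv.ge hx.1, hxi.symm⟩

lemma IsSplitFunctional.lowerHull_smul_posWeight [Finite ι] {S : Set (Set ι)}
    {h : ℝ × EuclideanSpace ℝ (Fin d)} (hS : IsSplitFunctional a S h) {c : ℝ} (hc : 0 ≤ c)
    (hy : y ∈ hull a Set.univ) :
    lowerHull a (c • posWeight a h) y = c * max (toAffine h y) 0 := by
  rcases hS.cover hy with hy | hy
  · have htight : {i | 0 ≤ toAffine h (a i)} ⊆ tight a (c • posWeight a h) (c • h) := by
      intro i hi
      simpa [tight, posWeight] using Or.inl hi
    rw [max_eq_left (apply_nonneg_of_mem_hull (fun _ => id) hy),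
      lowerHull_eq_of_mem_hull_tight (smul_mem_envelope_smul_posWeight hc)
        (hull_mono htight hy), map_smul]
    rfl
  · have htight : {i | toAffine h (a i) ≤ 0} ⊆ tight a (c • posWeight a h) 0 := by
      intro i hi
      simpa [tight, posWeight] using Or.inr hi
    rw [max_eq_right (apply_nonpos_of_mem_hull (fun _ => id) hy),
      lowerHull_eq_of_mem_hull_tight (zero_mem_envelope_smul_posWeight hc)
        (hull_mono htight hy), map_zero, mul_zero]
    rfl

end LowerHull

/-! ### Regular subdivisions and split prime weights -/

section RegularSubdivision

variable {a : ι → EuclideanSpace ℝ (Fin d)} {w : ι → ℝ} {x y : ℝ × EuclideanSpace ℝ (Fin d)}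
  {S : Set (Set ι)} {h : ℝ × EuclideanSpace ℝ (Fin d)}

lemma mem_lift : y ∈ lift a w ↔
    ∃ q ∈ convexHull ℝ (Set.range fun i => (w i, a i)), ∃ t : ℝ, 0 ≤ t ∧ q + (t, 0) = y := by
  simp [lift, Set.mem_add]

lemma mem_lift_of_mem_convexHull (hy : y ∈ convexHull ℝ (Set.range fun i => (w i, a i))) :
    y ∈ lift a w :=
  mem_lift.2 ⟨y, hy, 0, le_rfl, add_zero y⟩

lemma mk_mem_lift (i : ι) : (w i, a i) ∈ lift a w :=
  mem_lift_of_mem_convexHull (subset_convexHull ℝ _ ⟨i, rfl⟩)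

lemma add_mem_lift (hy : y ∈ lift a w) {t : ℝ} (ht : 0 ≤ t) : y + (t, 0) ∈ lift a w := by
  obtain ⟨q, hq, s, hs, rfl⟩ := mem_lift.1 hy
  exact mem_lift.2 ⟨q, hq, s + t, add_nonneg hs ht, by simp [add_assoc]⟩

lemma mem_envelope_iff_forall_mem_lift :
    x ∈ envelope a w ↔ ∀ y ∈ lift a w, toAffine x y.2 ≤ y.1 := by
  refine ⟨fun hx y hy => ?_, fun hx => mem_envelope.2 fun i => hx _ (mk_mem_lift i)⟩
  obtain ⟨q, hq, t, ht, rfl⟩ := mem_lift.1 hy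
  let f : ℝ × EuclideanSpace ℝ (Fin d) →ᵃ[ℝ] ℝ :=
    (toAffine x).comp (LinearMap.snd ℝ ℝ _).toAffineMap - (LinearMap.fst ℝ ℝ _).toAffineMap
  have hfq : f q ≤ 0 := apply_nonpos_of_mem_convexHull
    (Set.forall_mem_range.2 fun i => sub_nonpos.2 (mem_envelope.1 hx i)) hq
  have hq : toAffine x q.2 ≤ q.1 := sub_nonpos.1 hfq
  simpa using hq.trans (le_add_of_nonneg_right ht)

lemma mem_convexHull_of_toAffine_eq (hx : x ∈ envelope a w) (hy : y ∈ lift a w)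
    (hxy : toAffine x y.2 = y.1) : y ∈ convexHull ℝ (Set.range fun i => (w i, a i)) := by
  obtain ⟨q, hq, t, ht, rfl⟩ := mem_lift.1 hy
  have hqx := mem_envelope_iff_forall_mem_lift.1 hx q (mem_lift_of_mem_convexHull hq)
  have hxy : toAffine x q.2 = q.1 + t := by simpa using hxy
  obtain rfl : t = 0 := le_antisymm (by linarith) ht
  rwa [Prod.mk_zero_zero, add_zero]

lemma isExposed_setOf_toAffine_eq (hx : x ∈ envelope a w) :
    IsExposed ℝ (lift a w) {y ∈ lift a w | toAffine x y.2 = y.1} := by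
  rintro ⟨z, hz, hxz⟩
  let l : StrongDual ℝ (ℝ × EuclideanSpace ℝ (Fin d)) :=
    -((innerSL ℝ x.2).comp (ContinuousLinearMap.snd ℝ ℝ _) + ContinuousLinearMap.fst ℝ ℝ _)
  have hl (y : ℝ × EuclideanSpace ℝ (Fin d)) : l y = x.1 + (toAffine x y.2 - y.1) := by
    simp [l, toAffine_apply, real_inner_comm y.2]
    ring
  refine ⟨l, Set.ext fun y => and_congr_right fun hy => ?_⟩
  simp only [hl, add_le_add_iff_left]
  refine ⟨fun hxy y' hy' => ?_, fun hmax => ?_⟩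
  · simpa [hxy] using mem_envelope_iff_forall_mem_lift.1 hx y' hy'
  · have hle := hmax z hz
    rw [hxz, sub_self, sub_nonneg] at hle
    exact (mem_envelope_iff_forall_mem_lift.1 hx y hy).antisymm hle

lemma tight_mem_regularSubdivision [Finite ι] (hx : x ∈ envelope a w)
    (hne : (tight a w x).Nonempty) : tight a w x ∈ regularSubdivision a w := by
  refine ⟨{y ∈ lift a w | toAffine x y.2 = y.1}, hne.imp' (fun i => (w i, a i)) ?_,
    isExposed_setOf_toAffine_eq hx, ?_, ?_⟩
  · exact fun i hi => ⟨mk_mem_lift i, hi⟩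
  · exact ((Set.finite_range _).isCompact_convexHull (𝕜 := ℝ)).isBounded.subset
      fun y hy => mem_convexHull_of_toAffine_eq hx hy.1 hy.2
  · ext i
    exact (and_iff_right (mk_mem_lift i)).symm

/-- Otherwise the set of maximizers of `l` would contain a vertical ray. -/
lemma apply_one_zero_neg_of_isBounded {l : StrongDual ℝ (ℝ × EuclideanSpace ℝ (Fin d))}
    (hb : Bornology.IsBounded {y ∈ lift a w | ∀ y' ∈ lift a w, l y' ≤ l y}) (hy : y ∈ lift a w)
    (hmax : ∀ y' ∈ lift a w, l y' ≤ l y) : l (1, 0) < 0 := by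
  have hray (t : ℝ) : l (y + (t, 0)) = l y + t * l (1, 0) := by
    rw [map_add, ← smul_eq_mul t, ← map_smul]
    simp
  by_contra! hpos
  obtain ⟨R, hR⟩ := hb.exists_norm_le
  have hbound (t : ℝ) (ht : 0 ≤ t) : y.1 + t ≤ R := by
    refine (le_abs_self _).trans ((norm_fst_le (y + (t, 0))).trans (hR _ ⟨add_mem_lift hy ht, ?_⟩))
    refine fun y' hy' => (hmax y' hy').trans ?_
    rw [hray]
    exact le_add_of_nonneg_right (mul_nonneg ht hpos)
  have h1 := hbound 0 le_rfl
  have h2 := hbound (R - y.1 + 1) (by linarith)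
  linarith

lemma exists_subset_tight_of_mem_regularSubdivision {F : Set ι}
    (hF : F ∈ regularSubdivision a w) : ∃ x ∈ envelope a w, F ⊆ tight a w x := by
  obtain ⟨B, ⟨z, hz⟩, hB, hb, rfl⟩ := hF
  obtain ⟨l, rfl⟩ := hB ⟨z, hz⟩
  have hneg := apply_one_zero_neg_of_isBounded hb hz.1 hz.2
  obtain ⟨x, hx⟩ := exists_toAffine_of_strongDual l hneg.ne (l z)
  refine ⟨x, mem_envelope.2 fun i => ?_, fun i hi => ?_⟩
  · have hle := sub_nonpos.2 (hz.2 _ (mk_mem_lift i))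
    rw [hx] at hle
    exact sub_nonneg.1 (nonneg_of_mul_nonpos_right hle hneg)
  · have heq := sub_eq_zero.2 ((hz.2 _ hi.1).antisymm (hi.2 _ hz.1))
    rw [hx, mul_eq_zero, or_iff_right hneg.ne, sub_eq_zero] at heq
    exact heq.symm

lemma not_refines_regularSubdivision_iff [Finite ι] (hS : S.Nonempty) :
    ¬ Refines (regularSubdivision a w) S ↔ ∃ x ∈ envelope a w, ∀ G ∈ S, ¬ tight a w x ⊆ G := by
  simp only [Refines, not_forall, not_exists, not_and]
  constructor
  · rintro ⟨F, hF, hFS⟩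
    obtain ⟨x, hx, hFx⟩ := exists_subset_tight_of_mem_regularSubdivision hF
    exact ⟨x, hx, fun G hG hxG => hFS G hG (hFx.trans hxG)⟩
  · rintro ⟨x, hx, hxS⟩
    obtain ⟨G, hG⟩ := hS
    obtain ⟨i, hi, -⟩ := Set.not_subset.1 (hxS G hG)
    exact ⟨_, tight_mem_regularSubdivision hx ⟨i, hi⟩, hxS⟩

/-- Some affine minorant of `w` is tight at labels strictly on both sides of the hyperplane of
`h`: the regular subdivision of `w` has a cell that this hyperplane cuts properly. -/
def Crosses (a : ι → EuclideanSpace ℝ (Fin d)) (w : ι → ℝ)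
    (h : ℝ × EuclideanSpace ℝ (Fin d)) : Prop :=
  ∃ x ∈ envelope a w,
    (∃ i ∈ tight a w x, 0 < toAffine h (a i)) ∧ ∃ i ∈ tight a w x, toAffine h (a i) < 0

lemma crosses_neg : Crosses a w (-h) ↔ Crosses a w h := by
  simp [Crosses, and_comm]

lemma IsSplitFunctional.not_refines_iff [Finite ι] (hS : IsSplitFunctional a S h) :
    ¬ Refines (regularSubdivision a w) S ↔ Crosses a w h := by
  obtain ⟨p, hp⟩ := hS.exists_pos
  obtain ⟨q, hq⟩ := hS.exists_neg
  have hP : {i | 0 ≤ toAffine h (a i)} ∈ S := hS.eq_sides ▸ Or.inl (IsFace.refl ⟨p, hp.le⟩)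
  have hQ : {i | toAffine h (a i) ≤ 0} ∈ S := hS.eq_sides ▸ Or.inr (IsFace.refl ⟨q, hq.le⟩)
  rw [not_refines_regularSubdivision_iff ⟨_, hP⟩]
  refine exists_congr fun x => and_congr_right fun _ => ⟨fun hxS => ?_, ?_⟩
  · obtain ⟨i, hi, hi0⟩ := Set.not_subset.1 (hxS _ hQ)
    obtain ⟨j, hj, hj0⟩ := Set.not_subset.1 (hxS _ hP)
    exact ⟨⟨i, hi, not_le.1 hi0⟩, j, hj, not_le.1 hj0⟩
  · rintro ⟨⟨i, hi, hi0⟩, j, hj, hj0⟩ G hG hxG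
    rw [hS.eq_sides] at hG
    rcases hG with hG | hG
    · exact (hG.subset (hxG hj)).not_gt hj0
    · exact (hG.subset (hxG hi)).not_gt hi0

lemma exists_mem_envelope_mem_tight [Finite ι] {p : ι} (hp : a p ∉ hull a {p}ᶜ) :
    ∃ x ∈ envelope a w, p ∈ tight a w x := by
  obtain ⟨f, u, hfp, hf⟩ := geometric_hahn_banach_point_closed convex_hull isClosed_hull hp
  obtain ⟨M, hM⟩ := (Set.finite_range fun i => (w p - w i) / (f (a i) - f (a p))).bddAbove
  obtain ⟨x, hx⟩ := toAffine_surjective (AffineMap.const ℝ _ (w p) -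
    M • (f.toLinearMap.toAffineMap - AffineMap.const ℝ _ (f (a p))))
  have hxy (y : EuclideanSpace ℝ (Fin d)) : toAffine x y = w p - M * (f y - f (a p)) := by
    rw [hx]
    rfl
  refine ⟨x, mem_envelope.2 fun i => ?_, (hxy _).trans (by simp)⟩
  rw [hxy]
  rcases eq_or_ne i p with rfl | hi
  · simp
  · have hfi : 0 < f (a i) - f (a p) := sub_pos.2 (hfp.trans (hf _ (mem_hull hi)))
    exact sub_le_comm.1 ((div_le_iff₀ hfi).1 (hM ⟨i, rfl⟩))

lemma splitPrime_iff [Finite ι] (ha : affineSpan ℝ (Set.range a) = ⊤)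
    {h : TwoSplit a → ℝ × EuclideanSpace ℝ (Fin d)} (H : ∀ S, IsSplitFunctional a S.1 (h S)) :
    SplitPrime a w ↔ IsSupported a w ∧ ∀ S, Crosses a w (h S) := by
  constructor
  · refine fun hw => ⟨fun p => ?_, fun S => (H S).not_refines_iff.1 (hw S (Or.inr S.2))⟩
    by_cases hp : a p ∈ hull a {p}ᶜ
    · have hmem : {p}ᶜ ∈ pointSplit a p := IsFace.refl (hull_nonempty.1 ⟨_, hp⟩)
      obtain ⟨x, hx, hxS⟩ := (not_refines_regularSubdivision_iff ⟨_, hmem⟩).1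
        (hw _ (Or.inl (isKSplit_pointSplit ha hp)))
      obtain ⟨i, hi, hip⟩ := Set.not_subset.1 (hxS _ hmem)
      obtain rfl : i = p := not_not.1 hip
      exact ⟨x, hx, hi⟩
    · exact exists_mem_envelope_mem_tight hp
  · rintro ⟨hw, hcross⟩ S (hS | hS)
    · intro hr
      obtain ⟨p, hp⟩ := hS.exists_forall_notMem
      obtain ⟨x, hx, hpx⟩ := hw p
      obtain ⟨G, hG, hxG⟩ := hr _ (tight_mem_regularSubdivision hx ⟨p, hpx⟩)
      exact hp G hG (hxG hpx)
    · exact (H ⟨S, hS⟩).not_refines_iff.2 (hcross ⟨S, hS⟩)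

end RegularSubdivision

/-! ### Coherent decompositions -/

section Coherent

variable {a : ι → EuclideanSpace ℝ (Fin d)} {u v w : ι → ℝ} {c : ℝ}
  {x h : ℝ × EuclideanSpace ℝ (Fin d)}

/-- `u + v` is a coherent decomposition. The inclusion `⊇` of the Minkowski sum always holds. -/
def IsCoherent (a : ι → EuclideanSpace ℝ (Fin d)) (u v : ι → ℝ) : Prop :=
  envelope a (u + v) = envelope a u + envelope a v

lemma IsCoherent.exists_tight_subset (hc : IsCoherent a u v) (hx : x ∈ envelope a (u + v)) :
    ∃ y ∈ envelope a u, tight a (u + v) x ⊆ tight a u y := by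
  rw [hc] at hx
  obtain ⟨y, hy, z, hz, rfl⟩ := hx
  refine ⟨y, hy, fun i hi => ?_⟩
  have hi : toAffine y (a i) + toAffine z (a i) = u i + v i := by
    rw [← Pi.add_apply u v, ← hi, map_add]
    rfl
  exact ((add_eq_add_iff_eq_and_eq (mem_envelope.1 hy i) (mem_envelope.1 hz i)).1 hi).1

lemma IsSupported.of_isCoherent (hw : IsSupported a (u + v)) (hc : IsCoherent a u v) :
    IsSupported a u := by
  intro i
  obtain ⟨x, hx, hi⟩ := hw i
  obtain ⟨y, hy, hxy⟩ := hc.exists_tight_subset hx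
  exact ⟨y, hy, hxy hi⟩

lemma Crosses.of_isCoherent (hw : Crosses a (u + v) h) (hc : IsCoherent a u v) :
    Crosses a u h := by
  obtain ⟨x, hx, ⟨i, hi, hpos⟩, j, hj, hneg⟩ := hw
  obtain ⟨y, hy, hxy⟩ := hc.exists_tight_subset hx
  exact ⟨y, hy, ⟨i, hxy hi, hpos⟩, j, hxy hj, hneg⟩

lemma isCoherent_of_vertices_subset [Finite ι] (ha : affineSpan ℝ (Set.range a) = ⊤)
    (h : vertices a (u + v) ⊆ envelope a u + envelope a v) : IsCoherent a u v := by
  refine Set.Subset.antisymm (envelope_subset_of_convex ha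
    (convex_envelope.add convex_envelope) h ?_) ?_
  · rw [add_assoc, envelope_add_zero]
  · rintro _ ⟨x, hx, z, hz, rfl⟩
    exact add_mem_envelope hx hz

lemma posWeight_neg (i : ι) : posWeight a (-h) i = posWeight a h i - toAffine h (a i) := by
  simp only [posWeight, map_neg, AffineMap.coe_neg, Pi.neg_apply]
  rcases le_total (toAffine h (a i)) 0 with hi | hi <;> simp [hi]

lemma sub_smul_mem_envelope_iff : x - c • h ∈ envelope a (w - c • posWeight a h) ↔
    x ∈ envelope a (w - c • posWeight a (-h)) := by
  simp only [mem_envelope, toAffine_sub_smul, Pi.sub_apply, Pi.smul_apply, posWeight_neg,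
    smul_eq_mul, mul_sub, sub_sub_eq_add_sub, sub_le_iff_le_add, add_sub_right_comm]

lemma tight_sub_smul : tight a (w - c • posWeight a h) (x - c • h) =
    tight a (w - c • posWeight a (-h)) x := by
  ext i
  simp only [tight, Set.mem_ofPred_eq, toAffine_sub_smul, Pi.sub_apply, Pi.smul_apply,
    posWeight_neg, smul_eq_mul]
  constructor <;> intro hi <;> linear_combination hi

lemma Crosses.sub_smul_posWeight_of_neg (hw : Crosses a (w - c • posWeight a (-h)) (-h)) :
    Crosses a (w - c • posWeight a h) h := by
  obtain ⟨x, hx, hcross⟩ := crosses_neg.1 hw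
  refine ⟨x - c • h, sub_smul_mem_envelope_iff.2 hx, ?_⟩
  rwa [tight_sub_smul]

lemma mem_envelope_sub_smul_posWeight (hx : x ∈ envelope a w)
    (hmin : ∀ i, 0 < toAffine h (a i) → c * toAffine h (a i) ≤ w i - toAffine x (a i)) :
    x ∈ envelope a (w - c • posWeight a h) := by
  refine mem_envelope.2 fun i => le_sub_comm.1 ?_
  rw [Pi.smul_apply, smul_eq_mul, posWeight]
  rcases lt_or_ge 0 (toAffine h (a i)) with hi | hi
  · rw [max_eq_left hi.le]
    exact hmin i hi
  · rw [max_eq_right hi, mul_zero]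
    exact sub_nonneg.2 (mem_envelope.1 hx i)

lemma crosses_sub_smul_posWeight (hx : x ∈ vertices a w)
    (hle : ∀ i ∈ tight a w x, toAffine h (a i) ≤ 0)
    (hxc : x ∈ envelope a (w - c • posWeight a h)) {k : ι} (hk : 0 < toAffine h (a k))
    (heq : c * toAffine h (a k) = w k - toAffine x (a k)) :
    Crosses a (w - c • posWeight a h) h := by
  have hsub : tight a w x ⊆ tight a (w - c • posWeight a h) x := fun i hi => by
    simp [tight, posWeight, max_eq_right (hle i hi), Set.mem_ofPred_eq.le hi]
  refine ⟨x, hxc, ⟨k, ?_, hk⟩, ?_⟩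
  · simp [tight, posWeight, max_eq_left hk.le, heq]
  · by_contra! hge
    have h0 : h = 0 :=
      eq_zero_of_affineSpan_eq_top hx.2 fun i hi => (hle i hi).antisymm (hge i (hsub hi))
    simp [h0] at hk

/-- The number `c` is the least ratio `(w i - toAffine x (a i)) / |toAffine h (a i)|` over the
vertices `x` on one side and the labels `i` strictly on the other side of the hyperplane. -/
lemma exists_mem_envelope_sub_smul_posWeight [Finite ι] (ha : affineSpan ℝ (Set.range a) = ⊤)
    (hpos : ∃ i, 0 < toAffine h (a i)) (hneg : ∃ i, toAffine h (a i) < 0)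
    (hside : ∀ x ∈ vertices a w, ∃ g, (g = h ∨ g = -h) ∧ ∀ i ∈ tight a w x, toAffine g (a i) ≤ 0) :
    ∃ c : ℝ, 0 ≤ c ∧ Crosses a (w - c • posWeight a h) h ∧
      ∀ x ∈ vertices a w, ∀ g, (g = h ∨ g = -h) → (∀ i ∈ tight a w x, toAffine g (a i) ≤ 0) →
        x ∈ envelope a (w - c • posWeight a g) := by
  let R : Set ((ℝ × EuclideanSpace ℝ (Fin d)) × (ℝ × EuclideanSpace ℝ (Fin d)) × ι) :=
    {q | (q.1 ∈ vertices a w ∧ q.2.1 ∈ ({h, -h} : Set _)) ∧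
      (∀ i ∈ tight a w q.1, toAffine q.2.1 (a i) ≤ 0) ∧ 0 < toAffine q.2.1 (a q.2.2)}
  have hfin : R.Finite :=
    (finite_vertices.prod ((Set.toFinite {h, -h}).prod Set.finite_univ)).subset
      fun q hq => ⟨hq.1.1, hq.1.2, trivial⟩
  have hne : R.Nonempty := by
    obtain ⟨x, hx⟩ := vertices_nonempty (w := w) ha
    obtain ⟨g, hg, hle⟩ := hside x hx
    obtain ⟨i, hi⟩ : ∃ i, 0 < toAffine g (a i) := by
      rcases hg with rfl | rfl
      exacts [hpos, by simpa using hneg]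
    exact ⟨(x, g, i), ⟨hx, hg⟩, hle, hi⟩
  obtain ⟨⟨y, g, k⟩, ⟨⟨hy, hg⟩, hyg, hk⟩, hmin⟩ := Set.exists_min_image R
    (fun q => (w q.2.2 - toAffine q.1 (a q.2.2)) / toAffine q.2.1 (a q.2.2)) hfin hne
  set c := (w k - toAffine y (a k)) / toAffine g (a k)
  have hmem : ∀ x ∈ vertices a w, ∀ g, (g = h ∨ g = -h) →
      (∀ i ∈ tight a w x, toAffine g (a i) ≤ 0) → x ∈ envelope a (w - c • posWeight a g) :=
    fun x hx g hg hle => mem_envelope_sub_smul_posWeight hx.1 fun i hi =>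
      (le_div_iff₀ hi).1 (hmin (x, g, i) ⟨⟨hx, hg⟩, hle, hi⟩)
  have hcross : Crosses a (w - c • posWeight a g) g :=
    crosses_sub_smul_posWeight hy hyg (hmem y hy g hg hyg) hk (div_mul_cancel₀ _ hk.ne')
  refine ⟨c, div_nonneg (sub_nonneg.2 (mem_envelope.1 hy.1 k)) hk.le, ?_, hmem⟩
  rcases hg with rfl | rfl
  exacts [hcross, hcross.sub_smul_posWeight_of_neg]

lemma exists_isCoherent_crosses [Finite ι] (ha : affineSpan ℝ (Set.range a) = ⊤) (w : ι → ℝ)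
    (hpos : ∃ i, 0 < toAffine h (a i)) (hneg : ∃ i, toAffine h (a i) < 0) :
    ∃ (c : ℝ) (u : ι → ℝ), 0 ≤ c ∧ w = u + c • posWeight a h ∧
      IsCoherent a u (c • posWeight a h) ∧ Crosses a u h := by
  by_cases hcross : Crosses a w h
  · exact ⟨0, w, le_rfl, by simp, by simp [IsCoherent, envelope_add_zero], hcross⟩
  have hside : ∀ x ∈ vertices a w, ∃ g, (g = h ∨ g = -h) ∧
      ∀ i ∈ tight a w x, toAffine g (a i) ≤ 0 := by
    intro x hx
    by_contra! hcon
    refine hcross ⟨x, hx.1, hcon h (Or.inl rfl), ?_⟩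
    simpa using hcon (-h) (Or.inr rfl)
  obtain ⟨c, hc, hcross, hmem⟩ := exists_mem_envelope_sub_smul_posWeight ha hpos hneg hside
  refine ⟨c, w - c • posWeight a h, hc, by simp, isCoherent_of_vertices_subset ha ?_, hcross⟩
  rw [sub_add_cancel]
  intro x hx
  obtain ⟨g, rfl | rfl, hle⟩ := hside x hx
  · exact ⟨x, hmem x hx g (Or.inl rfl) hle, 0, zero_mem_envelope_smul_posWeight hc, add_zero x⟩
  · exact ⟨x - c • h, sub_smul_mem_envelope_iff.2 (hmem x hx _ (Or.inr rfl) hle), c • h,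
      smul_mem_envelope_smul_posWeight hc, sub_add_cancel _ _⟩

lemma exists_coherent_sum_crosses [Finite ι] {κ : Type*} (ha : affineSpan ℝ (Set.range a) = ⊤)
    {h : κ → ℝ × EuclideanSpace ℝ (Fin d)} (hpos : ∀ k, ∃ i, 0 < toAffine (h k) (a i))
    (hneg : ∀ k, ∃ i, toAffine (h k) (a i) < 0) (hw : IsSupported a w) (s : Finset κ) :
    ∃ (c : κ → ℝ) (u : ι → ℝ), (∀ k, 0 ≤ c k) ∧ w = u + ∑ k ∈ s, c k • posWeight a (h k) ∧
      envelope a w = envelope a u + ∑ k ∈ s, envelope a (c k • posWeight a (h k)) ∧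
      IsSupported a u ∧ ∀ k ∈ s, Crosses a u (h k) := by
  classical
  induction s using Finset.induction_on with
  | empty => exact ⟨0, w, fun _ => le_rfl, by simp, by simp, hw, by simp⟩
  | insert k s hk ih =>
    obtain ⟨c, u, hc, hwu, henv, hu, hcross⟩ := ih
    obtain ⟨r, v, hr, rfl, hcoh, hcross'⟩ := exists_isCoherent_crosses ha u (hpos k) (hneg k)
    have hupdate (j : κ) (hj : j ∈ s) : Function.update c k r j = c j :=
      Function.update_of_ne (ne_of_mem_of_not_mem hj hk) _ _
    refine ⟨Function.update c k r, v, fun j => ?_, ?_, ?_, hu.of_isCoherent hcoh,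
      Finset.forall_mem_insert _ _ _ |>.2 ⟨hcross', fun j hj => (hcross j hj).of_isCoherent hcoh⟩⟩
    · rcases eq_or_ne j k with rfl | hj
      · simpa using hr
      · simpa [hj] using hc j
    · rw [Finset.sum_insert hk, Function.update_self, Finset.sum_congr rfl fun j hj => by
        rw [hupdate j hj], ← add_assoc, hwu]
    · rw [Finset.sum_insert hk, Function.update_self, Finset.sum_congr rfl fun j hj => by
        rw [hupdate j hj], ← add_assoc, ← hcoh, henv]

end Coherent

section PointWeight

variable {a : ι → EuclideanSpace ℝ (Fin d)} {v w : ι → ℝ} {p : ι}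

lemma smul_pointWeight_eq_single [DecidableEq ι] (c : ℝ) :
    c • pointWeight p = Pi.single p c := by
  ext i
  rcases eq_or_ne i p with rfl | hi
  · simp [pointWeight]
  · simp [pointWeight, hi]

lemma envelope_smul_pointWeight (hp : a p ∈ hull a {p}ᶜ) {c : ℝ} (hc : 0 ≤ c) :
    envelope a (c • pointWeight p) = envelope a 0 := by
  classical
  rw [smul_pointWeight_eq_single]
  ext x
  simp only [mem_envelope]
  refine ⟨fun hx => ?_, fun hx i => (hx i).trans (Pi.single_nonneg.2 hc i)⟩
  have hcompl : ∀ i ∈ ({p}ᶜ : Set ι), toAffine x (a i) ≤ 0 := fun i hi => by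
    simpa [Pi.single_eq_of_ne hi] using hx i
  intro i
  rcases eq_or_ne i p with rfl | hi
  exacts [apply_nonpos_of_mem_hull hcompl hp, hcompl i hi]

lemma envelope_add_sum_pointWeight [Finite ι] {lam : OneSplit a → ℝ} (hlam : ∀ p, 0 ≤ lam p) :
    envelope a w + ∑ p, envelope a (lam p • pointWeight p.1) = envelope a w := by
  suffices ∀ s : Finset (OneSplit a),
      envelope a w + ∑ p ∈ s, envelope a (lam p • pointWeight p.1) = envelope a w from this _
  intro s
  induction s using Finset.cons_induction with
  | empty => simp
  | cons p s hp ih =>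
    rw [Finset.sum_cons, add_left_comm, ih,
      envelope_smul_pointWeight p.2.1.1.mem_hull_compl (hlam p), add_comm, envelope_add_zero]

lemma sum_smul_pointWeight_apply [Finite ι] (lam : OneSplit a → ℝ) (p : OneSplit a) :
    (∑ q, lam q • pointWeight q.1) p.1 = lam p := by
  classical
  simp_rw [smul_pointWeight_eq_single]
  rw [Finset.sum_apply, Finset.sum_eq_single p _ (by simp)]
  · simp
  · exact fun q _ hq => Pi.single_eq_of_ne (Subtype.coe_ne_coe.2 hq.symm) _

lemma sum_smul_pointWeight_apply_of_not [Finite ι] (lam : OneSplit a → ℝ)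
    (hp : ¬ IsKSplit a 1 (pointSplit a p)) : (∑ q, lam q • pointWeight q.1) p = 0 := by
  classical
  simp_rw [smul_pointWeight_eq_single]
  rw [Finset.sum_apply]
  refine Finset.sum_eq_zero fun q _ => Pi.single_eq_of_ne ?_ _
  rintro rfl
  exact hp q.2

lemma eq_add_sum_pointWeight [Finite ι] (ha : affineSpan ℝ (Set.range a) = ⊤)
    (hv : IsSupported a v) (henv : envelope a v = envelope a w) :
    w = v + ∑ p : OneSplit a, (w p.1 - v p.1) • pointWeight p.1 := by
  ext i
  rw [Pi.add_apply]
  by_cases hi : IsKSplit a 1 (pointSplit a i)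
  · rw [sum_smul_pointWeight_apply (fun p : OneSplit a => w p.1 - v p.1) ⟨i, hi⟩, add_sub_cancel]
  · obtain ⟨x, hx, hxi⟩ := exists_mem_envelope_mem_tight (w := w)
      fun h => hi (isKSplit_pointSplit ha h)
    rw [sum_smul_pointWeight_apply_of_not _ hi, add_zero, ← hv.lowerHull_apply,
      lowerHull_congr henv, lowerHull_eq_of_mem_hull_tight hx (mem_hull hxi)]
    exact hxi.symm

end PointWeight

/-! ### Second differences -/

section SecondDiff

variable {E : Type*} [AddCommGroup E] {z v : E}

/-- The second difference of a function at `z` along `v`, which detects how much the function bends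
at `z`. -/
def secondDiff (z v : E) : (E → ℝ) →ₗ[ℝ] ℝ where
  toFun φ := φ (z + v) + φ (z - v) - 2 * φ z
  map_add' φ ψ := by simp only [Pi.add_apply]; ring
  map_smul' c φ := by simp only [Pi.smul_apply, smul_eq_mul, RingHom.id_apply]; ring

lemma secondDiff_apply (φ : E → ℝ) :
    secondDiff z v φ = φ (z + v) + φ (z - v) - 2 * φ z := rfl

lemma secondDiff_congr {φ ψ : E → ℝ} {C : Set E} (h : Set.EqOn φ ψ C) (hz : z ∈ C)
    (hadd : z + v ∈ C) (hsub : z - v ∈ C) : secondDiff z v φ = secondDiff z v ψ := by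
  simp only [secondDiff_apply, h hz, h hadd, h hsub]

variable [Module ℝ E]

lemma secondDiff_affine (f : E →ᵃ[ℝ] ℝ) : secondDiff z v f = 0 := by
  rw [secondDiff_apply, sub_eq_add_neg z, affineMap_apply_add, affineMap_apply_add, map_neg]
  ring

lemma secondDiff_nonneg {φ : E → ℝ} {C : Set E} (hφ : ConvexOn ℝ C φ)
    (hadd : z + v ∈ C) (hsub : z - v ∈ C) : 0 ≤ secondDiff z v φ := by
  have h := hφ.2 hadd hsub (by norm_num : (0 : ℝ) ≤ 1 / 2) (by norm_num) (add_halves 1)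
  have hz : (1 / 2 : ℝ) • (z + v) + (1 / 2 : ℝ) • (z - v) = z := by module
  rw [hz, smul_eq_mul, smul_eq_mul] at h
  rw [secondDiff_apply]
  linarith

lemma secondDiff_max_zero_of_apply_eq_zero {f : E →ᵃ[ℝ] ℝ} (hz : f z = 0) :
    secondDiff z v (fun y => max (f y) 0) = |f.linear v| := by
  rw [secondDiff_apply, sub_eq_add_neg z, affineMap_apply_add, affineMap_apply_add, hz, map_neg,
    zero_add, zero_add, max_self, mul_zero, sub_zero, max_zero_add_max_neg_zero_eq_abs_self]

end SecondDiff

section Affine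

variable {E : Type*} [NormedAddCommGroup E] {C U : Set E} {z : E}

lemma eventually_add_mem_and_sub_mem (hU : U ∈ 𝓝 z) :
    ∀ᶠ v in 𝓝 (0 : E), z + v ∈ U ∧ z - v ∈ U := by
  have hadd : Filter.Tendsto (fun v => z + v) (𝓝 0) (𝓝 z) :=
    (continuous_const_add z).tendsto' _ _ (add_zero z)
  have hsub : Filter.Tendsto (fun v => z - v) (𝓝 0) (𝓝 z) :=
    (continuous_const.sub continuous_id).tendsto' _ _ (sub_zero z)
  exact (hadd.eventually hU).and (hsub.eventually hU)

variable [NormedSpace ℝ E] {f g : E →ᵃ[ℝ] ℝ}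

lemma frequently_linear_ne_zero (hf : f.linear ≠ 0) : ∃ᶠ v in 𝓝 (0 : E), f.linear v ≠ 0 := by
  intro hker
  simp only [ne_eq, not_not] at hker
  exact hf (LinearMap.ker_eq_top.1 (Submodule.eq_top_of_nonempty_interior' _
    ⟨0, mem_interior_iff_mem_nhds.2 hker⟩))

lemma exists_mem_apply_eq_zero_apply_ne_zero (hf : f.linear ≠ 0) (hg : ∀ c : ℝ, g ≠ c • f)
    (hU : IsOpen U) (hz : z ∈ U) (hfz : f z = 0) : ∃ y ∈ U, f y = 0 ∧ g y ≠ 0 := by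
  by_cases hgz : g z = 0
  swap
  · exact ⟨z, hz, hfz, hgz⟩
  obtain ⟨y, hfy, hgy⟩ : ∃ y, f y = 0 ∧ g y ≠ 0 := by
    by_contra! hcon
    exact (exists_eq_smul_of_forall_eq_zero hf hcon).elim hg
  have hline : Filter.Tendsto (AffineMap.lineMap z y) (𝓝[≠] (0 : ℝ)) (𝓝 z) := by
    have hcont : Continuous (AffineMap.lineMap z y : ℝ → E) := AffineMap.lineMap_continuous
    simpa using (hcont.tendsto 0).mono_left nhdsWithin_le_nhds
  obtain ⟨t, htU, ht⟩ :=
    ((hline.eventually (hU.mem_nhds hz)).and self_mem_nhdsWithin).exists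
  refine ⟨_, htU, ?_, ?_⟩
  · rw [AffineMap.apply_lineMap, hfz, hfy, AffineMap.lineMap_same_apply]
  · rw [AffineMap.apply_lineMap, hgz, AffineMap.lineMap_apply_ring', add_zero, sub_zero]
    exact mul_ne_zero ht hgy

variable [FiniteDimensional ℝ E]

lemma eventually_secondDiff_max_zero_eq_zero (hz : f z ≠ 0) :
    ∀ᶠ v in 𝓝 (0 : E), secondDiff z v (fun y => max (f y) 0) = 0 := by
  have hf := f.continuous_of_finiteDimensional
  rcases hz.lt_or_gt with hz | hz
  · have hU : {y | f y < 0} ∈ 𝓝 z := (isOpen_lt hf continuous_const).mem_nhds hz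
    filter_upwards [eventually_add_mem_and_sub_mem hU] with v hv
    rw [secondDiff_congr (ψ := (0 : E → ℝ)) (C := {y | f y < 0}) (fun y hy => ?_) hz hv.1 hv.2,
      map_zero]
    exact max_eq_right (le_of_lt hy)
  · have hU : {y | 0 < f y} ∈ 𝓝 z := (isOpen_lt continuous_const hf).mem_nhds hz
    filter_upwards [eventually_add_mem_and_sub_mem hU] with v hv
    rw [secondDiff_congr (ψ := f) (fun y hy => max_eq_left (le_of_lt hy)) hz hv.1 hv.2,
      secondDiff_affine]

lemma exists_mem_interior_apply_eq_zero (hC : Convex ℝ C) (hne : (interior C).Nonempty)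
    (hpos : ∃ y ∈ C, 0 < f y) (hneg : ∃ y ∈ C, f y < 0) : ∃ z ∈ interior C, f z = 0 := by
  have hf := f.continuous_of_finiteDimensional
  have hmeet {V : Set E} (hV : IsOpen V) (hVC : ∃ y ∈ C, y ∈ V) : ∃ y ∈ interior C, y ∈ V := by
    obtain ⟨y, hy, hyV⟩ := hVC
    have hy' : y ∈ closure (interior C) :=
      hC.closure_interior_eq_closure_of_nonempty_interior hne ▸ subset_closure hy
    obtain ⟨z, hzV, hz⟩ := mem_closure_iff.1 hy' V hV hyV
    exact ⟨z, hz, hzV⟩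
  obtain ⟨p, hp, hfp⟩ := hmeet (isOpen_lt continuous_const hf) hpos
  obtain ⟨q, hq, hfq⟩ := hmeet (isOpen_lt hf continuous_const) hneg
  exact hC.interior.isPreconnected.intermediate_value hq hp hf.continuousOn ⟨hfq.le, hfp.le⟩

lemma exists_mem_apply_eq_zero_forall_apply_ne_zero {κ : Type*} {g : κ → E →ᵃ[ℝ] ℝ}
    (s : Finset κ) (hf : f.linear ≠ 0) (hg : ∀ j ∈ s, ∀ c : ℝ, g j ≠ c • f)
    (hU : IsOpen U) (hz : z ∈ U) (hfz : f z = 0) :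
    ∃ y ∈ U, f y = 0 ∧ ∀ j ∈ s, g j y ≠ 0 := by
  induction s using Finset.cons_induction generalizing U with
  | empty => exact ⟨z, hz, hfz, by simp⟩
  | cons j s hj ih =>
    rw [Finset.forall_mem_cons] at hg
    obtain ⟨y, hy, hfy, hgy⟩ := ih hg.2 hU hz
    have hopen : IsOpen (U ∩ {y | ∀ j ∈ s, g j y ≠ 0}) := by
      refine hU.inter ?_
      simp only [Set.ofPred_forall]
      exact isOpen_biInter_finset fun j _ =>
        isOpen_ne_fun (g j).continuous_of_finiteDimensional continuous_const
    obtain ⟨x, ⟨hx, hgx⟩, hfx, hgjx⟩ :=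
      exists_mem_apply_eq_zero_apply_ne_zero hf hg.1 hopen ⟨hy, hgy⟩ hfy
    exact ⟨x, hx, hfx, (Finset.forall_mem_cons _ _).2 ⟨hgjx, hgx⟩⟩

lemma coeff_le_of_convexOn_add_sum_eq {κ : Type*} [Fintype κ] {φ : E → ℝ} {l : E →ᵃ[ℝ] ℝ}
    {g : κ → E →ᵃ[ℝ] ℝ} {c c' : κ → ℝ} {k : κ} (hφ : ConvexOn ℝ C φ)
    (hne : (interior C).Nonempty)
    (heq : ∀ y ∈ C, φ y + ∑ j, c j * max (g j y) 0 = l y + ∑ j, c' j * max (g j y) 0)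
    (hk : (g k).linear ≠ 0) (hj : ∀ j ≠ k, ∀ r : ℝ, g j ≠ r • g k)
    (hpos : ∃ y ∈ C, 0 < g k y) (hneg : ∃ y ∈ C, g k y < 0) : c k ≤ c' k := by
  classical
  obtain ⟨z₀, hz₀, hkz₀⟩ := exists_mem_interior_apply_eq_zero hφ.1 hne hpos hneg
  obtain ⟨z, hz, hkz, hjz⟩ := exists_mem_apply_eq_zero_forall_apply_ne_zero
    (Finset.univ.erase k) hk (fun j hjk => hj j (Finset.ne_of_mem_erase hjk)) isOpen_interior
    hz₀ hkz₀
  obtain ⟨v, hkv, hv, hvj⟩ := ((frequently_linear_ne_zero hk).and_eventually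
    ((eventually_add_mem_and_sub_mem (mem_interior_iff_mem_nhds.1 hz)).and
      (Filter.eventually_all_finset _ |>.2 fun j hjk =>
        eventually_secondDiff_max_zero_eq_zero (hjz j hjk)))).exists
  have hsum (b : κ → ℝ) : secondDiff z v (∑ j, b j • fun y => max (g j y) 0) =
      b k * |(g k).linear v| := by
    rw [map_sum, Finset.sum_eq_single_of_mem k (Finset.mem_univ k), map_smul, smul_eq_mul,
      secondDiff_max_zero_of_apply_eq_zero hkz]
    intro j _ hjk
    rw [map_smul, hvj j (Finset.mem_erase.2 ⟨hjk, Finset.mem_univ j⟩), smul_zero]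
  have hdiff : secondDiff z v (φ + ∑ j, c j • fun y => max (g j y) 0) =
      secondDiff z v (l + ∑ j, c' j • fun y => max (g j y) 0) :=
    secondDiff_congr (fun y hy => by simpa using heq y hy) (interior_subset hz) hv.1 hv.2
  rw [map_add, map_add, hsum, hsum, secondDiff_affine, zero_add] at hdiff
  refine le_of_mul_le_mul_right ?_ (abs_pos.2 hkv)
  linarith [secondDiff_nonneg hφ hv.1 hv.2]

end Affine

/-! ### Existence and uniqueness -/

section SplitDecomposition

variable [Finite ι] {a : ι → EuclideanSpace ℝ (Fin d)} {side : TwoSplit a → Set ι}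
  {w w₀ w₀' : ι → ℝ} {lam lam' : OneSplit a → ℝ} {mu mu' : TwoSplit a → ℝ}
  {h : TwoSplit a → ℝ × EuclideanSpace ℝ (Fin d)}

lemma IsSplitDecomposition.lowerHull_eq (D : IsSplitDecomposition a side w w₀ lam mu)
    (H : ∀ S, IsSplitFunctional a S.1 (h S))
    (hweight : ∀ S, splitWeight a S.1 (side S) = posWeight a (h S)) {y : EuclideanSpace ℝ (Fin d)}
    (hy : y ∈ hull a Set.univ) :
    lowerHull a w y = lowerHull a w₀ y + ∑ S, mu S * max (toAffine (h S) y) 0 := by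
  have henv := D.coherent
  rw [envelope_add_sum_pointWeight D.lam_nonneg] at henv
  simp only [lowerHull_of_envelope_eq_add_sum henv hy, hweight,
    (H _).lowerHull_smul_posWeight (D.mu_nonneg _) hy]

lemma IsSplitDecomposition.mu_le (D : IsSplitDecomposition a side w w₀ lam mu)
    (D' : IsSplitDecomposition a side w w₀' lam' mu') (ha : affineSpan ℝ (Set.range a) = ⊤)
    (H : ∀ S, IsSplitFunctional a S.1 (h S))
    (hweight : ∀ S, splitWeight a S.1 (side S) = posWeight a (h S)) : mu ≤ mu' := by
  intro S
  obtain ⟨x, hx, ⟨i, hi, hpos⟩, j, hj, hneg⟩ := ((splitPrime_iff ha H).1 D'.prime).2 S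
  obtain ⟨x', hx', hsub⟩ := exists_mem_vertices ha hx
  have hC := hull_mono (a := a) (Set.subset_univ (tight a w₀' x'))
  refine coeff_le_of_convexOn_add_sum_eq (convexOn_lowerHull.subset hC convex_hull)
    (φ := lowerHull a w₀) (l := toAffine x') (g := fun T => toAffine (h T)) (k := S)
    (interior_hull_nonempty hx'.2) (fun y hy => ?_)
    (toAffine_linear_ne_zero (norm_ne_zero_iff.1 ((H S).norm_eq ▸ one_ne_zero)))
    (fun T hTS r hr => hTS ?_) ⟨_, mem_hull (hsub hi), hpos⟩ ⟨_, mem_hull (hsub hj), hneg⟩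
  · rw [← D.lowerHull_eq H hweight (hC hy), D'.lowerHull_eq H hweight (hC hy),
      lowerHull_eq_of_mem_hull_tight hx'.1 hy]
  · rw [← map_smul] at hr
    exact Subtype.ext ((H S).eq_of_smul (toAffine_injective hr ▸ H T)).symm

lemma IsSplitDecomposition.unique (D : IsSplitDecomposition a side w w₀ lam mu)
    (D' : IsSplitDecomposition a side w w₀' lam' mu') (ha : affineSpan ℝ (Set.range a) = ⊤)
    (H : ∀ S, IsSplitFunctional a S.1 (h S))
    (hweight : ∀ S, splitWeight a S.1 (side S) = posWeight a (h S)) :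
    w₀ = w₀' ∧ lam = lam' ∧ mu = mu' := by
  obtain rfl : mu = mu' := (D.mu_le D' ha H hweight).antisymm (D'.mu_le D ha H hweight)
  obtain rfl : w₀ = w₀' := funext fun i => by
    have hi := mem_hull (a := a) (Set.mem_univ i)
    rw [← ((splitPrime_iff ha H).1 D.prime).1.lowerHull_apply i,
      ← ((splitPrime_iff ha H).1 D'.prime).1.lowerHull_apply i]
    exact add_right_cancel ((D.lowerHull_eq H hweight hi).symm.trans (D'.lowerHull_eq H hweight hi))
  have hlam : ∑ p, lam p • pointWeight p.1 = ∑ p, lam' p • pointWeight p.1 :=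
    add_left_cancel (add_right_cancel (D.sum_eq.symm.trans D'.sum_eq))
  refine ⟨rfl, funext fun p => ?_, rfl⟩
  rw [← sum_smul_pointWeight_apply lam p, hlam, sum_smul_pointWeight_apply]

lemma exists_isSplitDecomposition (ha : affineSpan ℝ (Set.range a) = ⊤)
    (H : ∀ S, IsSplitFunctional a S.1 (h S))
    (hweight : ∀ S, splitWeight a S.1 (side S) = posWeight a (h S)) (w : ι → ℝ) :
    ∃ w₀ lam mu, IsSplitDecomposition a side w w₀ lam mu := by
  obtain ⟨v, hv, henv, hle⟩ := exists_isSupported_envelope_eq ha w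
  obtain ⟨mu, w₀, hmu, hsum, hcoh, hsupp, hcross⟩ := exists_coherent_sum_crosses ha
    (fun S => (H S).exists_pos) (fun S => (H S).exists_neg) hv Finset.univ
  have hlam (p : OneSplit a) : 0 ≤ w p.1 - v p.1 := sub_nonneg.2 (hle p.1)
  refine ⟨w₀, fun p => w p.1 - v p.1, mu, hlam, hmu,
    (splitPrime_iff ha H).2 ⟨hsupp, fun S => hcross S (Finset.mem_univ S)⟩, ?_, ?_⟩
  · simp only [hweight]
    rw [add_right_comm, ← hsum]
    exact eq_add_sum_pointWeight ha hv henv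
  · simp only [hweight]
    rw [envelope_add_sum_pointWeight hlam, ← hcoh, henv]

end SplitDecomposition

end PointConfig

end

open PointConfig in
theorem mainTheorem7 {d : ℕ} {ι : Type*} [Finite ι] (a : ι → EuclideanSpace ℝ (Fin d))
    (ha : affineSpan ℝ (Set.range a) = ⊤)
    (side : PointConfig.TwoSplit a → Set ι)
    (hside : ∀ S, side S ∈ PointConfig.maximalFaces S.1)
    (w : ι → ℝ) :
    ∃! D : (ι → ℝ) × (PointConfig.OneSplit a → ℝ) × (PointConfig.TwoSplit a → ℝ),
      PointConfig.IsSplitDecomposition a side w D.1 D.2.1 D.2.2 := by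
  choose h H hP using fun S : TwoSplit a => S.2.exists_isSplitFunctional_of_mem (hside S)
  have hw (S : TwoSplit a) : splitWeight a S.1 (side S) = posWeight a (h S) := by
    rw [hP S, (H S).splitWeight_eq]
  obtain ⟨w₀, lam, mu, D⟩ := exists_isSplitDecomposition ha H hw w
  refine ⟨(w₀, lam, mu), D, fun ⟨w₀', lam', mu'⟩ D' => ?_⟩
  obtain ⟨rfl, rfl, rfl⟩ := IsSplitDecomposition.unique D' D ha H hw
  rfl
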